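/- For a positive integer $n$, a polynomial $P\in\mathbb{Z}[X_1,\dots,X_n]$, an integer $m>1$ and real numbers $B_1,\dots,B_n\ge 1$, let $$\rho_P(m)=\#\{x\in(\mathbb{Z}/m\mathbb{Z})^n : P(x)\equiv 0 \bmod m\},$$ let $N_P(B_1,\dots,B_n)$ be the number of integer points $x\in\prod_{j=1}^n[0,B_j]$ for which $P(x)$ is a non-zero square-free integer, and let $$\mathscr{C}_P=\prod_{p\ \mathrm{prime}}\left(1-\frac{\rho_P(p^2)}{p^{2n}}\right).$$ Assume the following conjecture: for every $n\ge 1$ and every $P\in\mathbb{Z}[X_1,\dots,X_n]$ of total degree at least $2$, one has $N_P(B_1,\dots,B_n)\sim\mathscr{C}_P B_1\cdots B_n$ as $\min_j B_j\to\infty$, in the sense that $$\frac{N_P(B_1,\dots,B_n)}{B_1\cdots B_n}\longrightarrow\mathscr{C}_P .$$ Then for every integer $g\ge 5$ and every $\varepsilon>0$ there are constants $c>0$ and $X_0$, depending only on $g$ and $\varepsilon$, such that for all real $X\ge X_0$ the number of square-free integers $d$ with $1<d\le X$ for which there is an injective group homomorphism $(\mathbb{Z}/g\mathbb{Z})^2\hookrightarrow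 \mathrm{Cl}(\mathbb{Q}(\sqrt{-d}))$ into the ideal class group of $\mathbb{Q}(\sqrt{-d})$ is at least $c\,X^{\frac{1}{g-1}-\varepsilon}$. -/

import Mathlib

/-- `ρ_P(m)`: the number of zeros of `P` modulo `m`, that is, of `X ∈ (ℤ/mℤ)ⁿ` with
`P(X) ≡ 0 mod m`. -/
noncomputable def rootCountMod {n : ℕ} (P : MvPolynomial (Fin n) ℤ) (m : ℕ) : ℕ :=
  Nat.card {x : Fin n → ZMod m // MvPolynomial.aeval x P = 0}

/-- `N_P(B)`: the number of integer points `X` of the box `∏ⱼ [0, Bⱼ]` at which `P(X)` is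
a (nonzero) square-free integer, of either sign. -/
noncomputable def squarefreeValueCount {n : ℕ} (P : MvPolynomial (Fin n) ℤ)
    (B : Fin n → ℝ) : ℕ :=
  Set.ncard {x : Fin n → ℤ |
    (∀ j, 0 ≤ x j ∧ (x j : ℝ) ≤ B j) ∧ Squarefree (MvPolynomial.eval x P)}

/-- The local factor `1 - ρ_P(p²) / p^{2n}`. -/
noncomputable def localSquarefreeDensity {n : ℕ} (P : MvPolynomial (Fin n) ℤ)
    (p : ℕ) : ℝ :=
  1 - (rootCountMod P (p ^ 2) : ℝ) / (p : ℝ) ^ (2 * n)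

/-- `𝒞_P = ∏_p (1 - ρ_P(p²) / p^{2n})`, the product over all primes `p`. -/
noncomputable def squarefreeDensity {n : ℕ} (P : MvPolynomial (Fin n) ℤ) : ℝ :=
  ∏' p : Nat.Primes, localSquarefreeDensity P p

/-- All local factors lie in `[0, 1]`. -/
theorem localSquarefreeDensity_mem_Icc {n : ℕ} (P : MvPolynomial (Fin n) ℤ)
    (p : Nat.Primes) : localSquarefreeDensity P p ∈ Set.Icc (0 : ℝ) 1 := by
  have hp : 0 < (p : ℕ) := p.2.pos
  have : NeZero ((p : ℕ) ^ 2) := ⟨(pow_pos hp 2).ne'⟩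
  have h1 : rootCountMod P ((p : ℕ) ^ 2) ≤ (p : ℕ) ^ (2 * n) := by
    have h := Finite.card_subtype_le
      (fun x : Fin n → ZMod ((p : ℕ) ^ 2) => MvPolynomial.aeval x P = 0)
    have h2 : Nat.card (Fin n → ZMod ((p : ℕ) ^ 2)) = (p : ℕ) ^ (2 * n) := by
      simp [Nat.card_eq_fintype_card, ZMod.card, pow_mul]
    exact h.trans h2.le
  have hpos : (0 : ℝ) < ((p : ℕ) : ℝ) ^ (2 * n) := by positivity
  have h3 : (rootCountMod P ((p : ℕ) ^ 2) : ℝ) ≤ ((p : ℕ) : ℝ) ^ (2 * n) := by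
    exact_mod_cast h1
  unfold localSquarefreeDensity
  constructor
  · have := (div_le_one hpos).2 h3
    linarith
  · have : (0 : ℝ) ≤ (rootCountMod P ((p : ℕ) ^ 2) : ℝ) / ((p : ℕ) : ℝ) ^ (2 * n) := by
      positivity
    linarith

/-- The product defining `𝒞_P` always converges (possibly to `0`), so the infinite product
in `squarefreeDensity` never takes a junk value. -/
theorem multipliable_localSquarefreeDensity {n : ℕ} (P : MvPolynomial (Fin n) ℤ) :
    Multipliable (fun p : Nat.Primes => localSquarefreeDensity P p) := by
  have h := localSquarefreeDensity_mem_Icc P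
  refine ⟨⨅ s : Finset Nat.Primes, ∏ p ∈ s, localSquarefreeDensity P p, ?_⟩
  rw [HasProd, SummationFilter.unconditional_filter]
  refine tendsto_atTop_ciInf ?_ ⟨0, ?_⟩
  · intro s t hst
    change ∏ p ∈ t, localSquarefreeDensity P p ≤ ∏ p ∈ s, localSquarefreeDensity P p
    rw [← Finset.prod_sdiff hst]
    exact mul_le_of_le_one_left (Finset.prod_nonneg fun p _ => (h p).1)
      (Finset.prod_le_one (fun p _ => (h p).1) fun p _ => (h p).2)
  · rintro _ ⟨s, rfl⟩
    exact Finset.prod_nonneg fun p _ => (h p).1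

/-- The conjecture on the density of square-free values of integral multivariate polynomials:
for every `n` and every `P ∈ ℤ[X₁, …, Xₙ]` of total degree at least `2`,
`N_P(B) ∼ 𝒞_P B₁ ⋯ Bₙ` as `min Bⱼ → ∞`, that is, `N_P(B) / (B₁ ⋯ Bₙ) → 𝒞_P`
(which also makes sense when `𝒞_P = 0`). The filter `atTop` of the pointwise order on `Fin n → ℝ`
is the filter `min Bⱼ → ∞`; the `Bⱼ` tend to infinity independently of each other. -/
def SquarefreeDensityConjecture : Prop :=
  ∀ (n : ℕ) (P : MvPolynomial (Fin n) ℤ), 2 ≤ P.totalDegree →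
    Filter.Tendsto (fun B : Fin n → ℝ => (squarefreeValueCount P B : ℝ) / ∏ j, B j)
      Filter.atTop (nhds (squarefreeDensity P))

/-- The imaginary quadratic field `ℚ(√-d)`, as a subfield of `ℂ`. -/
noncomputable abbrev imaginaryQuadraticField (d : ℕ) : IntermediateField ℚ ℂ :=
  IntermediateField.adjoin ℚ {Complex.I * (Real.sqrt (d : ℝ) : ℂ)}

/-- `CL(-d)`: the ideal class group of (the ring of integers of) `ℚ(√-d)`. -/
noncomputable abbrev imaginaryQuadraticClassGroup (d : ℕ) : Type :=
  ClassGroup (NumberField.RingOfIntegers (imaginaryQuadraticField d))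

/-- `N_H(X)`: the number of square-free integers `d` with `1 < d ≤ X` such that the abelian
group `H` embeds into the class group of `ℚ(√-d)`. -/
noncomputable def classGroupEmbeddingCount (H : Type*) [AddCommGroup H] (X : ℝ) : ℕ :=
  Set.ncard {d : ℕ | 1 < d ∧ Squarefree d ∧ (d : ℝ) ≤ X ∧
    ∃ φ : H →+ Additive (imaginaryQuadraticClassGroup d), Function.Injective φ}

/-! Write A = C + h, u = h r^g, v = (A^g - C^g)/h. Since uv = r^g (A^g - C^g), the number d =
4(rA)^g - (u+v)^2 also equals 4(rC)^g - (u-v)^2. For square-free d, each representation 4k^g = t^2 +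
d makes (t + √-d)/2 coprime to its conjugate, so it generates the g-th power of an ideal of norm k.
This gives two classes killed by g.

They are independent when (u+v)^2 ≤ d. A relation with exponents m, n ≤ g/2 gives a generator (x +
y√-d)/2 of norm at most (rA)^g ≤ d/2, hence |y| ≤ 1. If y = 0, unique factorization gives (rA)^m =
(rC)^n, so m = n = 0 because A and C are coprime. If |y| = 1, the norm is too large unless m = n =
g/2, and that case fails on comparing coordinates (`sqrt_mul_ne`).

For the count, the conjecture is applied to d as a polynomial in (r, C, h). Its density is positive:
no p^2 divides all values, and there are O(p^4) zeros modulo p^2 (`sum_card_discRoots_le`). Take r ≍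
R, C ≍ M, h ≍ H with R^g ≍ M^(g-2), H ≍ M and M^(2g-2) ≍ X; then d ≤ X, and ≫ RMH triples give
square-free d. Equal values of d come from factorizations of 4(c^g - c'^g) with c = rC, c' = r'C',
so the divisor bound allows at most (RM)^2 X^ε coincident pairs, up to a constant
(`card_discForm_eq_le`). By Cauchy–Schwarz there are ≫ (RMH)^2 / ((RM)^2 X^ε) = H^2 X^(-ε) ≍
X^(1/(g-1)-ε) distinct d. -/

/-! ### Independent torsion elements and g-th powers of ideals -/

/-- Two elements of a commutative group which are killed by `g`, and whose small powers satisfy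
no relation, generate a copy of `(ℤ/g)²`. -/
theorem exists_injective_zmod_prod {G : Type*} [CommGroup G] {g : ℕ} (hg : 0 < g) (x y : G)
    (hx : x ^ g = 1) (hy : y ^ g = 1)
    (h : ∀ m n : ℕ, 2 * m ≤ g → 2 * n ≤ g → (x ^ m * y ^ n = 1 ∨ x ^ m = y ^ n) →
      m = 0 ∧ n = 0) :
    ∃ φ : ZMod g × ZMod g →+ Additive G, Function.Injective φ := by
  -- Up to inversion, the four sign patterns of the exponents are the two relations excluded by `h`.
  have key : ∀ i j : ℤ, 2 * |i| ≤ g → 2 * |j| ≤ g → x ^ i * y ^ j = 1 → i = 0 ∧ j = 0 := by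
    intro i j hi hj hij
    obtain ⟨m, rfl | rfl⟩ := i.eq_nat_or_neg <;> obtain ⟨n, rfl | rfl⟩ := j.eq_nat_or_neg <;>
      simp only [abs_neg, Nat.abs_cast] at hi hj <;>
      simp only [zpow_neg, zpow_natCast, mul_inv_eq_one, inv_mul_eq_one, ← mul_inv,
        inv_eq_one] at hij <;>
      · have := h m n (by omega) (by omega) (by tauto)
        omega
  have key2 : ∀ i j : ℤ, x ^ i * y ^ j = 1 → (g : ℤ) ∣ i ∧ (g : ℤ) ∣ j := by
    intro i j hij
    have hg' : 0 < g := hg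
    -- Exponents are replaced by their balanced residues modulo g, of absolute value at most g/2.
    have e1 : ∀ (z : G) (k : ℤ), z ^ g = 1 → z ^ k = z ^ (k.bmod g) := by
      intro z k hz
      conv_lhs => rw [← Int.bmod_add_bdiv k g]
      rw [zpow_add, zpow_mul, zpow_natCast, hz, one_zpow, mul_one]
    have hb : ∀ k : ℤ, 2 * |k.bmod g| ≤ g := by
      intro k
      have h1 := Int.le_bmod (x := k) hg'
      have h2 := Int.bmod_lt (x := k) hg'
      rcases abs_cases (k.bmod g) with ⟨h3, _⟩ | ⟨h3, _⟩ <;> rw [h3] <;> omega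
    rw [e1 x i hx, e1 y j hy] at hij
    obtain ⟨h1, h2⟩ := key _ _ (hb i) (hb j) hij
    exact ⟨Int.dvd_of_bmod_eq_zero h1, Int.dvd_of_bmod_eq_zero h2⟩
  let f (z : G) (hz : z ^ g = 1) : ZMod g →+ Additive G :=
    ZMod.lift g ⟨zmultiplesHom _ (Additive.ofMul z), by
      simp only [zmultiplesHom_apply, natCast_zsmul]
      rw [← ofMul_pow, hz, ofMul_one]⟩
  have hf : ∀ (z : G) (hz : z ^ g = 1) (k : ℤ), f z hz k = Additive.ofMul (z ^ k) := by
    intro z hz k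
    simp [f, ZMod.lift_coe]
  refine ⟨(f x hx).coprod (f y hy), ?_⟩
  rw [injective_iff_map_eq_zero]
  rintro ⟨i, j⟩ hij
  obtain ⟨i, rfl⟩ := ZMod.intCast_surjective i
  obtain ⟨j, rfl⟩ := ZMod.intCast_surjective j
  rw [AddMonoidHom.coprod_apply, hf x hx, hf y hy, ← ofMul_mul, ofMul_eq_zero] at hij
  obtain ⟨h1, h2⟩ := key2 i j hij
  rw [Prod.mk_eq_zero, ZMod.intCast_zmod_eq_zero_iff_dvd, ZMod.intCast_zmod_eq_zero_iff_dvd]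
  exact ⟨h1, h2⟩

/-- In a Dedekind domain, coprime factors of a `g`-th power generate `g`-th powers of ideals. -/
theorem exists_ideal_pow_eq_span {R : Type*} [CommRing R] [IsDedekindDomain R] {g : ℕ}
    (hg : g ≠ 0) {x y a : R} (hxy : IsCoprime x y) (h : x * y = a ^ g) :
    ∃ I J : Ideal R, I ^ g = Ideal.span {x} ∧ J ^ g = Ideal.span {y} ∧ I * J = Ideal.span {a} := by
  classical
  let : GCDMonoid (Ideal R) := UniqueFactorizationMonoid.toGCDMonoid _
  have hc : IsCoprime (Ideal.span {x}) (Ideal.span {y}) := by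
    rw [Ideal.isCoprime_span_singleton_iff]; exact hxy
  have hI : Ideal.span {x} * Ideal.span {y} = Ideal.span {a} ^ g := by
    rw [Ideal.span_singleton_mul_span_singleton, h, Ideal.span_singleton_pow]
  have hu : ∀ {A B : Ideal R}, IsCoprime A B → IsUnit (gcd A B) := fun hAB =>
    hAB.isUnit_of_dvd' (gcd_dvd_left _ _) (gcd_dvd_right _ _)
  obtain ⟨I, hI'⟩ := exists_eq_pow_of_mul_eq_pow (hu hc) hI
  obtain ⟨J, hJ'⟩ := exists_eq_pow_of_mul_eq_pow (hu hc.symm) ((mul_comm _ _).trans hI)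
  refine ⟨I, J, hI'.symm, hJ'.symm, ?_⟩
  have : (I * J) ^ g = Ideal.span {a} ^ g := by rw [mul_pow, ← hI', ← hJ', hI]
  exact pow_left_injective hg this

/-! ### Integers and units of ℚ(√-d) -/

/-- A chosen square root of `-d` in `ℂ`. -/
noncomputable abbrev sqrtNeg (d : ℕ) : ℂ := Complex.I * (Real.sqrt (d : ℝ) : ℂ)

theorem sqrtNeg_sq (d : ℕ) : sqrtNeg d ^ 2 = -(d : ℂ) := by
  rw [sqrtNeg, mul_pow, Complex.I_sq, ← Complex.ofReal_pow, Real.sq_sqrt d.cast_nonneg]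
  simp

theorem conj_sqrtNeg (d : ℕ) : (starRingEnd ℂ) (sqrtNeg d) = -sqrtNeg d := by
  simp [sqrtNeg]

theorem normSq_add_mul_sqrtNeg (d : ℕ) (x y : ℤ) :
    Complex.normSq (x + y * sqrtNeg d) = x ^ 2 + d * y ^ 2 := by
  have h := Real.sq_sqrt (d.cast_nonneg (α := ℝ))
  simp [sqrtNeg, Complex.normSq_apply]
  linear_combination (y : ℝ) ^ 2 * h

theorem normSq_eq_of_two_mul_eq {d : ℕ} {x y : ℤ} {z : ℂ} (h : 2 * z = x + y * sqrtNeg d) :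
    4 * Complex.normSq z = x ^ 2 + d * y ^ 2 := by
  rw [← normSq_add_mul_sqrtNeg, ← h, map_mul]
  norm_num [Complex.normSq_apply]

theorem sqrtNeg_linearIndependent {d : ℕ} (hd : 0 < d) {x y x' y' : ℤ}
    (h : (x + y * sqrtNeg d : ℂ) = x' + y' * sqrtNeg d) : x = x' ∧ y = y' := by
  have hs : (0 : ℝ) < Real.sqrt d := Real.sqrt_pos.2 (by exact_mod_cast hd)
  have h1 := congrArg Complex.re h
  have h2 := congrArg Complex.im h
  simp [sqrtNeg] at h1 h2
  refine ⟨h1, h2.resolve_right (by omega)⟩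

theorem isIntegral_sqrtNeg (d : ℕ) : IsIntegral ℤ (sqrtNeg d) := by
  refine IsIntegral.of_pow (n := 2) two_pos ?_
  rw [sqrtNeg_sq]
  have h := (isIntegral_algebraMap (R := ℤ) (x := (d : ℤ)) (A := ℂ)).neg
  simpa using h

instance numberField_imaginaryQuadraticField (d : ℕ) :
    NumberField (imaginaryQuadraticField d) where
  to_charZero := inferInstance
  to_finiteDimensional :=
    IntermediateField.adjoin.finiteDimensional (isIntegral_sqrtNeg d).tower_top

theorem exists_rat_add_mul_sqrtNeg (d : ℕ) {z : ℂ} (hz : z ∈ imaginaryQuadraticField d) :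
    ∃ p q : ℚ, z = p + q * sqrtNeg d := by
  have hs := sqrtNeg_sq d
  induction hz using IntermediateField.adjoin_induction with
  | mem x hx => exact ⟨0, 1, by rw [Set.mem_singleton_iff.1 hx]; simp⟩
  | algebraMap x => exact ⟨x, 0, by simp⟩
  | add x y _ _ hx hy =>
    obtain ⟨p, q, rfl⟩ := hx
    obtain ⟨p', q', rfl⟩ := hy
    exact ⟨p + p', q + q', by push_cast; ring⟩
  | mul x y _ _ hx hy =>
    obtain ⟨p, q, rfl⟩ := hx
    obtain ⟨p', q', rfl⟩ := hy
    refine ⟨p * p' - q * q' * d, p * q' + p' * q, ?_⟩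
    push_cast
    linear_combination (q : ℂ) * q' * hs
  | inv x _ hx =>
    obtain ⟨p, q, rfl⟩ := hx
    by_cases h0 : (p + q * sqrtNeg d : ℂ) = 0
    · exact ⟨0, 0, by rw [h0]; simp⟩
    · have h1 : (p - q * sqrtNeg d : ℂ) ≠ 0 := by
        intro h
        apply h0
        have := congrArg (starRingEnd ℂ) h
        rw [map_sub, map_mul, conj_sqrtNeg] at this
        simpa using this
      have h2 : ((p : ℂ) ^ 2 + d * q ^ 2) = (p + q * sqrtNeg d) * (p - q * sqrtNeg d) := by
        linear_combination (q : ℂ) ^ 2 * hs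
      have h3 : ((p : ℂ) ^ 2 + d * q ^ 2) ≠ 0 := by rw [h2]; exact mul_ne_zero h0 h1
      refine ⟨p / (p ^ 2 + d * q ^ 2), -q / (p ^ 2 + d * q ^ 2), ?_⟩
      push_cast
      have h4 : ((p / (p ^ 2 + d * q ^ 2) : ℂ) + -q / (p ^ 2 + d * q ^ 2) * sqrtNeg d) =
          (p - q * sqrtNeg d) / (p ^ 2 + d * q ^ 2) := by ring
      rw [h4, h2, div_mul_cancel_right₀ h1]

theorem exists_int_of_isIntegral_ratCast {q : ℚ} (h : IsIntegral ℤ (q : ℂ)) :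
    ∃ n : ℤ, (n : ℚ) = q := by
  have h' : IsIntegral ℤ (algebraMap ℚ ℂ q) := by simpa using h
  rw [isIntegral_algebraMap_iff (algebraMap ℚ ℂ).injective] at h'
  obtain ⟨n, hn⟩ := IsIntegrallyClosed.isIntegral_iff.1 h'
  exact ⟨n, by simpa using hn⟩

/-- The square of the denominator of q is coprime to the numerator, so it divides d. -/
theorem exists_int_of_sq_mul_squarefree {d : ℕ} (hd : Squarefree d) {q : ℚ} {n : ℤ}
    (h : (n : ℚ) = q ^ 2 * d) : ∃ m : ℤ, (m : ℚ) = q := by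
  have h1 : (q.den : ℚ) ≠ 0 := by exact_mod_cast q.den_nz
  have h2 : (n * (q.den : ℤ) ^ 2 : ℤ) = q.num ^ 2 * d := by
    have : (n : ℚ) * q.den ^ 2 = q.num ^ 2 * d := by
      rw [h]
      have h3 : q * q.den = q.num := Rat.mul_den_eq_num q
      linear_combination (q * q.den + q.num) * d * h3
    exact_mod_cast this
  have h3 : ((q.den : ℤ) ^ 2) ∣ d := by
    have hc : IsCoprime ((q.den : ℤ) ^ 2) (q.num ^ 2) := by
      apply IsCoprime.pow
      rw [Int.isCoprime_iff_gcd_eq_one, Int.gcd_comm]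
      exact q.reduced
    exact hc.dvd_of_dvd_mul_left ⟨n, by rw [← h2]; ring⟩
  have h4 : q.den * q.den ∣ d := by
    rw [← sq]; exact_mod_cast h3
  have h5 : q.den = 1 := Nat.isUnit_iff.1 (hd _ h4)
  exact ⟨q.num, (Rat.den_eq_one_iff q).1 h5⟩

/-- The embedding of the ring of integers of `ℚ(√-d)` into `ℂ`. -/
noncomputable abbrev ringOfIntegersToComplex (d : ℕ) :
    NumberField.RingOfIntegers (imaginaryQuadraticField d) →+* ℂ :=
  (algebraMap (imaginaryQuadraticField d) ℂ).comp (algebraMap _ (imaginaryQuadraticField d))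

theorem ringOfIntegersToComplex_injective (d : ℕ) :
    Function.Injective (ringOfIntegersToComplex d) :=
  (algebraMap (imaginaryQuadraticField d) ℂ).injective.comp
    NumberField.RingOfIntegers.coe_injective

/-- For x = p + q√-d the trace 2p and -(x - x̄)^2 = (2q)^2 d are rational algebraic integers, and
square-freeness of d then makes 2q an integer. The parity conditions on m and n are not needed. -/
theorem exists_two_mul_eq {d : ℕ} (hd : Squarefree d)
    (x : NumberField.RingOfIntegers (imaginaryQuadraticField d)) :
    ∃ m n : ℤ, 2 * ringOfIntegersToComplex d x = m + n * sqrtNeg d := by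
  obtain ⟨p, q, hpq⟩ := exists_rat_add_mul_sqrtNeg d (x : imaginaryQuadraticField d).2
  have hx : ringOfIntegersToComplex d x = p + q * sqrtNeg d := hpq
  have hi : IsIntegral ℤ (ringOfIntegersToComplex d x) :=
    (NumberField.RingOfIntegers.isIntegral x).map (ringOfIntegersToComplex d).toIntAlgHom
  have hi' : IsIntegral ℤ (starRingEnd ℂ (ringOfIntegersToComplex d x)) :=
    hi.map (starRingEnd ℂ).toIntAlgHom
  have hs := sqrtNeg_sq d
  rw [hx] at hi hi' ⊢
  rw [map_add, map_mul, conj_sqrtNeg] at hi'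
  simp only [map_ratCast] at hi'
  have e1 : ((2 * p : ℚ) : ℂ) = p + q * sqrtNeg d + (p + q * -sqrtNeg d) := by push_cast; ring
  have e2 : (((2 * q) ^ 2 * d : ℚ) : ℂ) =
      -(p + q * sqrtNeg d - (p + q * -sqrtNeg d)) ^ 2 := by
    push_cast
    linear_combination 4 * (q : ℂ) ^ 2 * hs
  obtain ⟨m, hm⟩ := exists_int_of_isIntegral_ratCast (e1 ▸ hi.add hi')
  obtain ⟨n, hn⟩ := exists_int_of_isIntegral_ratCast (e2 ▸ ((hi.sub hi').pow 2).neg)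
  obtain ⟨k, hk⟩ := exists_int_of_sq_mul_squarefree hd hn
  refine ⟨m, k, ?_⟩
  have hm' : (m : ℂ) = 2 * p := by exact_mod_cast congrArg (Rat.cast (K := ℂ)) hm
  have hk' : (k : ℂ) = 2 * q := by exact_mod_cast congrArg (Rat.cast (K := ℂ)) hk
  rw [hm', hk']; ring

/-- (b + √-d)/2 is a root of X^2 - bX + k. -/
theorem exists_ringOfIntegers_two_mul_eq {d : ℕ} {b k : ℤ} (h : b ^ 2 + d = 4 * k) :
    ∃ x : NumberField.RingOfIntegers (imaginaryQuadraticField d),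
      2 * ringOfIntegersToComplex d x = b + sqrtNeg d := by
  set z : ℂ := (b + sqrtNeg d) / 2 with hz
  have hmem : z ∈ imaginaryQuadraticField d := by
    refine div_mem (add_mem (intCast_mem _ _) (IntermediateField.mem_adjoin_simple_self _ _)) ?_
    exact ofNat_mem _ 2
  have h' : (b : ℂ) ^ 2 + d = 4 * k := by exact_mod_cast h
  have hint : IsIntegral ℤ z := by
    refine ⟨Polynomial.X ^ 2 - Polynomial.C b * Polynomial.X +
      Polynomial.C k, ?_, ?_⟩
    · monicity!
    · have hs := sqrtNeg_sq d
      rw [← Polynomial.aeval_def]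
      simp only [map_add, map_sub, map_mul, map_pow, Polynomial.aeval_X, Polynomial.aeval_C,
        algebraMap_int_eq]
      simp only [eq_intCast]
      rw [hz]
      linear_combination (1 / 4 : ℂ) * hs - 1 / 4 * h'
  have hint' : IsIntegral ℤ (⟨z, hmem⟩ : imaginaryQuadraticField d) := by
    rw [← isIntegral_algebraMap_iff (algebraMap (imaginaryQuadraticField d) ℂ).injective]
    exact hint
  refine ⟨⟨⟨z, hmem⟩, hint'⟩, ?_⟩
  change 2 * z = _
  rw [hz]; ring

open NumberField in
/-- A product of powers of two integers of `ℚ(√-d)` of norms `a ^ g` and `c ^ g` which are coprime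
to their conjugates can only be rational if `a ^ m = c ^ n`. -/
theorem pow_eq_pow_of_conj_eq {d : ℕ} {g m n a c : ℕ} (hg : g ≠ 0)
    {α α' β β' : 𝓞 (imaginaryQuadraticField d)}
    (hα : IsCoprime α α') (hβ : IsCoprime β β')
    (hαn : Complex.normSq (ringOfIntegersToComplex d α) = a ^ g)
    (hβn : Complex.normSq (ringOfIntegersToComplex d β') = c ^ g)
    (hu : ∀ ε : (𝓞 (imaginaryQuadraticField d))ˣ,
      Complex.normSq (ringOfIntegersToComplex d ε) = 1)
    (h : α ^ m * β ^ n = α' ^ m * β' ^ n) : a ^ m = c ^ n := by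
  -- Coprimality to the conjugates makes α^m and β'^n divide each other; their norms then agree.
  have h1 : α ^ m ∣ β' ^ n := (hα.pow (m := m) (n := m)).dvd_of_dvd_mul_left ⟨_, h.symm⟩
  have h2 : β' ^ n ∣ α ^ m :=
    (hβ.symm.pow (m := n) (n := n)).dvd_of_dvd_mul_right ⟨α' ^ m, by rw [h, mul_comm]⟩
  obtain ⟨ε, hε⟩ := associated_of_dvd_dvd h1 h2
  have h3 := congrArg (fun x => Complex.normSq (ringOfIntegersToComplex d x)) hε
  simp only [map_mul, map_pow, hαn, hβn, hu, mul_one] at h3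
  have h4 : (a ^ m) ^ g = (c ^ n) ^ g := by
    have : ((a : ℝ) ^ g) ^ m = ((c : ℝ) ^ g) ^ n := h3
    rw [← pow_mul, ← pow_mul, mul_comm m, mul_comm n, pow_mul, pow_mul]
    exact_mod_cast this
  exact Nat.pow_left_injective hg h4

open NumberField in
-- A unit has norm 1, that is x^2 + d y^2 = 4, and d > 4 forces y = 0.
theorem unit_eq_one_or_neg_one {d : ℕ} (hd : Squarefree d) (h4 : 4 < d)
    (ε : (𝓞 (imaginaryQuadraticField d))ˣ) :
    ringOfIntegersToComplex d ε = 1 ∨ ringOfIntegersToComplex d ε = -1 := by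
  obtain ⟨x, y, hxy⟩ := exists_two_mul_eq hd (ε : 𝓞 (imaginaryQuadraticField d))
  obtain ⟨x', y', hxy'⟩ := exists_two_mul_eq hd ((ε⁻¹ : _ˣ) : 𝓞 (imaginaryQuadraticField d))
  have h1 := normSq_eq_of_two_mul_eq hxy
  have h2 := normSq_eq_of_two_mul_eq hxy'
  have h3 : Complex.normSq (ringOfIntegersToComplex d ε) *
      Complex.normSq (ringOfIntegersToComplex d ((ε⁻¹ : _ˣ) : 𝓞 (imaginaryQuadraticField d))) = 1 := by
    rw [← map_mul, ← map_mul, ← Units.val_mul, mul_inv_cancel]; simp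
  have h5 : (x ^ 2 + d * y ^ 2) * (x' ^ 2 + d * y' ^ 2) = 16 := by
    have : ((x ^ 2 + d * y ^ 2) * (x' ^ 2 + d * y' ^ 2) : ℝ) = 16 := by
      rw [← h1, ← h2]; linear_combination 16 * h3
    exact_mod_cast this
  have h6 : (4 : ℤ) < d := by exact_mod_cast h4
  -- The norm of z is rational and integral, hence an integer.
  have even : ∀ (t w : ℤ) (z : 𝓞 (imaginaryQuadraticField d)),
      2 * ringOfIntegersToComplex d z = t + w * sqrtNeg d → ∃ k : ℤ, t ^ 2 + d * w ^ 2 = 4 * k := by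
    intro t w z hz
    have hi : IsIntegral ℤ (ringOfIntegersToComplex d z) :=
      (RingOfIntegers.isIntegral z).map (ringOfIntegersToComplex d).toIntAlgHom
    have hi' : IsIntegral ℤ (starRingEnd ℂ (ringOfIntegersToComplex d z)) :=
      hi.map (starRingEnd ℂ).toIntAlgHom
    have e : (((t ^ 2 + d * w ^ 2 : ℤ) / 4 : ℚ) : ℂ) =
        ringOfIntegersToComplex d z * starRingEnd ℂ (ringOfIntegersToComplex d z) := by
      rw [Complex.mul_conj]
      have := normSq_eq_of_two_mul_eq hz
      have h7 : Complex.normSq (ringOfIntegersToComplex d z) = (t ^ 2 + d * w ^ 2) / 4 := by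
        linarith
      rw [h7]; push_cast; ring
    obtain ⟨k, hk⟩ := exists_int_of_isIntegral_ratCast (e ▸ hi.mul hi')
    refine ⟨k, ?_⟩
    have : ((t ^ 2 + d * w ^ 2 : ℤ) : ℚ) = (4 * k : ℤ) := by push_cast at hk ⊢; linarith
    exact_mod_cast this
  obtain ⟨k, hk⟩ := even x y _ hxy
  obtain ⟨k', hk'⟩ := even x' y' _ hxy'
  rw [hk, hk'] at h5
  have hk0 : 0 ≤ k := by nlinarith [sq_nonneg x, sq_nonneg y]
  have h8 : k * k' = 1 := by linarith
  have hk1 : k = 1 := by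
    rcases Int.mul_eq_one_iff_eq_one_or_neg_one.1 h8 with h | h <;> omega
  rw [hk1] at hk
  have hy : y = 0 := by
    by_contra hy
    have : 1 ≤ y ^ 2 := by have := Int.one_le_abs hy; nlinarith [sq_abs y]
    nlinarith [sq_nonneg x]
  rw [hy] at hk hxy
  have hx : (x - 2) * (x + 2) = 0 := by linear_combination hk
  rcases mul_eq_zero.1 hx with h | h
  · left
    have : (x : ℂ) = 2 := by exact_mod_cast (by omega : x = 2)
    rw [this] at hxy
    linear_combination hxy / 2
  · right
    have : (x : ℂ) = -2 := by exact_mod_cast (by omega : x = -2)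
    rw [this] at hxy
    linear_combination hxy / 2

/-! ### Independence of the two ideal classes -/

/-- The equation excluding a small principal ideal which is not generated by an integer. -/
theorem sqrt_mul_ne {d b e u v x : ℤ} {y η : ℤ} (hb : b = u + v)
    (he : e = u - v ∨ e = v - u) (hu : 0 < u) (hv : 0 < v) (hbd : b ^ 2 ≤ d)
    (hy : y ^ 2 = 1) (hη : η = 1 ∨ η = -1) (h1 : x ^ 2 - d * y ^ 2 = η * (b * e - d))
    (h2 : 2 * x * y = η * (b + e)) : False := by
  subst hb
  have hη2 : η ^ 2 = 1 := by rcases hη with rfl | rfl <;> norm_num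
  have h3 : 4 * x ^ 2 = (u + v + e) ^ 2 := by
    have : (2 * x * y) ^ 2 = (η * (u + v + e)) ^ 2 := by rw [h2]
    linear_combination this - 4 * x ^ 2 * hy + (u + v + e) ^ 2 * hη2
  rw [hy] at h1
  have huv := mul_pos hu hv
  have := pow_pos hu 2
  have := pow_pos hv 2
  -- Say e = u - v, so x^2 = u^2 and be = u^2 - v^2. Then η = 1 gives v = 0, while η = -1 gives 2d =
  -- 2u^2 - v^2, against d ≥ (u+v)^2. The other case swaps u and v.
  rcases he with rfl | rfl <;> rcases hη with rfl | rfl <;> nlinarith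

theorem eq_one_of_sq_mul_le {d y B : ℤ} (hd : 0 < d) (h : d * y ^ 2 ≤ B) (hB : B < 4 * d) :
    y = 0 ∨ y ^ 2 = 1 := by
  have h1 : y ^ 2 < 2 ^ 2 := by nlinarith
  have h2 := abs_lt_of_sq_lt_sq h1 (by norm_num)
  rw [abs_lt] at h2
  obtain ⟨h2, h3⟩ := h2
  interval_cases y <;> simp

open NumberField in
/-- Two ideals whose `g`-th powers are generated by `(b + √-d) / 2` and `(e + √-d) / 2` have no
multiplicative relation with exponents at most `g / 2`. -/
theorem exponents_eq_zero_of_principal {d g m n a c : ℕ} {b e u v : ℤ} (hd : Squarefree d)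
    (hg : 3 ≤ g) {α β γ : 𝓞 (imaginaryQuadraticField d)} {I J : Ideal (𝓞 (imaginaryQuadraticField d))}
    (hα : 2 * ringOfIntegersToComplex d α = b + sqrtNeg d)
    (hβ : 2 * ringOfIntegersToComplex d β = e + sqrtNeg d)
    (hαc : IsCoprime α (b - α)) (hβc : IsCoprime β (e - β))
    (hI : I ^ g = Ideal.span {α}) (hJ : J ^ g = Ideal.span {β})
    (hγ : I ^ m * J ^ n = Ideal.span {γ})
    (hb : b = u + v) (he : e = u - v ∨ e = v - u) (hu : 0 < u) (hv : 0 < v)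
    (hba : b ^ 2 + d = 4 * (a : ℤ) ^ g) (hec : e ^ 2 + d = 4 * (c : ℤ) ^ g)
    (hbd : b ^ 2 ≤ d) (ha : 3 ≤ a) (hca : c ≤ a) (hm : 2 * m ≤ g) (hn : 2 * n ≤ g)
    (hac : a ^ m = c ^ n → m = 0 ∧ n = 0) : m = 0 ∧ n = 0 := by
  have hg0 : g ≠ 0 := by omega
  have hag : 27 ≤ (a : ℤ) ^ g := by
    have h1 : 3 ^ 3 ≤ a ^ g := (Nat.pow_le_pow_left ha 3).trans (Nat.pow_le_pow_right (by omega) hg)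
    exact_mod_cast h1
  -- From b^2 ≤ d and b^2 + d = 4a^g one gets d ≥ 2a^g, the size bound used throughout.
  have hd4 : 4 < d := by
    have : (4 : ℤ) < d := by linarith
    exact_mod_cast this
  have hdpos : (0 : ℤ) < d := by omega
  have hconj : ∀ (t : ℤ) (x : 𝓞 (imaginaryQuadraticField d)),
      2 * ringOfIntegersToComplex d x = t + sqrtNeg d →
      ringOfIntegersToComplex d (t - x) = starRingEnd ℂ (ringOfIntegersToComplex d x) := by
    intro t x hx
    have h1 := congrArg (starRingEnd ℂ) hx
    rw [map_mul, map_add, conj_sqrtNeg] at h1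
    rw [map_sub]
    simp only [map_intCast, map_ofNat] at h1 ⊢
    linear_combination -hx / 2 - h1 / 2
  have hnorm : ∀ (t : ℤ) (k : ℕ) (x : 𝓞 (imaginaryQuadraticField d)),
      2 * ringOfIntegersToComplex d x = t + sqrtNeg d → t ^ 2 + d = 4 * (k : ℤ) ^ g →
      Complex.normSq (ringOfIntegersToComplex d x) = k ^ g := by
    intro t k x hx hk
    have h1 := normSq_eq_of_two_mul_eq (d := d) (x := t) (y := 1)
      (z := ringOfIntegersToComplex d x) (by rw [hx]; simp)
    have h2 : (t : ℝ) ^ 2 + d = 4 * (k : ℝ) ^ g := by exact_mod_cast hk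
    push_cast at h1
    linarith
  have hunit : ∀ ε : (𝓞 (imaginaryQuadraticField d))ˣ,
      Complex.normSq (ringOfIntegersToComplex d ε) = 1 := by
    intro ε
    rcases unit_eq_one_or_neg_one hd hd4 ε with h | h <;> rw [h] <;> simp
  have assoc : ∀ {x y : 𝓞 (imaginaryQuadraticField d)}, Ideal.span {x} = Ideal.span {y} →
      ∃ η : ℤ, (η = 1 ∨ η = -1) ∧
        ringOfIntegersToComplex d x = η * ringOfIntegersToComplex d y := by
    intro x y hxy
    obtain ⟨ε, hε⟩ := (Ideal.span_singleton_eq_span_singleton.1 hxy).symm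
    have h1 := congrArg (ringOfIntegersToComplex d) hε
    rw [map_mul] at h1
    rcases unit_eq_one_or_neg_one hd hd4 ε with h | h <;> rw [h] at h1
    · exact ⟨1, Or.inl rfl, by rw [← h1]; simp⟩
    · exact ⟨-1, Or.inr rfl, by rw [← h1]; simp⟩
  obtain ⟨η, hη, hγg⟩ := assoc (x := γ ^ g) (y := α ^ m * β ^ n) (by
    rw [← Ideal.span_singleton_pow, ← hγ, mul_pow, ← pow_mul, ← pow_mul, mul_comm m, mul_comm n,
      pow_mul, pow_mul, hI, hJ, Ideal.span_singleton_pow, Ideal.span_singleton_pow,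
      Ideal.span_singleton_mul_span_singleton])
  have hηn : Complex.normSq (η : ℂ) = 1 := by rcases hη with rfl | rfl <;> simp
  have hη0 : (η : ℂ) ≠ 0 := by rcases hη with rfl | rfl <;> simp
  obtain ⟨x, y, hxy⟩ := exists_two_mul_eq hd γ
  have hN : Complex.normSq (ringOfIntegersToComplex d γ) = (a : ℝ) ^ m * (c : ℝ) ^ n := by
    have h1 := congrArg Complex.normSq hγg
    simp only [map_mul, map_pow, hηn, one_mul, hnorm b a α hα hba, hnorm e c β hβ hec] at h1
    rw [← pow_mul, ← pow_mul, mul_comm g, mul_comm g, pow_mul, pow_mul, ← mul_pow] at h1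
    exact (pow_left_inj₀ (Complex.normSq_nonneg _) (by positivity) hg0).1 h1
  have hN2 : x ^ 2 + d * y ^ 2 = 4 * ((a : ℤ) ^ m * (c : ℤ) ^ n) := by
    have h1 := normSq_eq_of_two_mul_eq hxy
    rw [hN] at h1
    exact_mod_cast h1.symm
  have hle : d * y ^ 2 ≤ 4 * (a : ℤ) ^ (m + n) := by
    have h1 : a ^ m * c ^ n ≤ a ^ (m + n) := by
      rw [pow_add]; exact Nat.mul_le_mul_left _ (Nat.pow_le_pow_left hca n)
    have h2 : (a : ℤ) ^ m * (c : ℤ) ^ n ≤ (a : ℤ) ^ (m + n) := by exact_mod_cast h1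
    nlinarith [sq_nonneg x]
  -- If y = 0 then γ is its own conjugate, hence so is α^m β^n = ±γ^g.
  have hreal : y = 0 → m = 0 ∧ n = 0 := by
    rintro rfl
    apply hac
    have hz : starRingEnd ℂ (ringOfIntegersToComplex d γ) = ringOfIntegersToComplex d γ := by
      have h1 : ringOfIntegersToComplex d γ = x / 2 := by
        push_cast at hxy
        linear_combination hxy / 2
      rw [h1, map_div₀, map_intCast, map_ofNat]
    have h1 : ringOfIntegersToComplex d (α ^ m * β ^ n) =
        ringOfIntegersToComplex d ((b - α) ^ m * (e - β) ^ n) := by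
      have h2 := congrArg (starRingEnd ℂ) hγg
      rw [map_pow, map_pow, hz, ← map_pow, hγg] at h2
      simp only [map_mul, map_pow, hconj b α hα, hconj e β hβ, map_intCast] at h2 ⊢
      exact mul_left_cancel₀ hη0 h2
    refine pow_eq_pow_of_conj_eq hg0 hαc hβc (hnorm b a α hα hba) ?_ hunit
      (ringOfIntegersToComplex_injective d h1)
    rw [hconj e β hβ, Complex.normSq_conj]
    exact hnorm e c β hβ hec
  have hpow : (a : ℤ) ^ (m + n) ≤ (a : ℤ) ^ g := by
    exact_mod_cast Nat.pow_le_pow_right (by omega) (by omega)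
  -- d y^2 ≤ 4a^(m+n) ≤ 4a^g ≤ 2d leaves only y = 0 and y^2 = 1.
  rcases eq_one_of_sq_mul_le hdpos hle (by linarith) with hy | hy
  · exact hreal hy
  by_cases hmn : m + n = g
  · exfalso
    obtain rfl : m = n := by omega
    -- Here m = n = g/2, so γ^2 generates (IJ)^g and γ^2 = ±αβ.
    obtain ⟨κ, hκ, hγ2⟩ := assoc (x := γ ^ 2) (y := α * β) (by
      rw [← Ideal.span_singleton_pow, ← hγ, ← mul_pow, ← pow_mul, show m * 2 = g by omega, mul_pow,
        hI, hJ, Ideal.span_singleton_mul_span_singleton])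
    have hs := sqrtNeg_sq d
    have h1 : (((x ^ 2 - d * y ^ 2 : ℤ) : ℂ) + ((2 * x * y : ℤ) : ℂ) * sqrtNeg d) =
        ((κ * (b * e - d) : ℤ) : ℂ) + ((κ * (b + e) : ℤ) : ℂ) * sqrtNeg d := by
      rw [map_pow, map_mul] at hγ2
      push_cast
      have h2 : (2 * ringOfIntegersToComplex d γ) ^ 2 =
          κ * ((2 * ringOfIntegersToComplex d α) * (2 * ringOfIntegersToComplex d β)) := by
        linear_combination 4 * hγ2
      rw [hxy, hα, hβ] at h2
      linear_combination h2 - y ^ 2 * hs + κ * hs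
    obtain ⟨h2, h3⟩ := sqrtNeg_linearIndependent (by omega) h1
    exact sqrt_mul_ne hb he hu hv hbd hy hκ h2 h3
  · exfalso
    -- Now d ≤ 4a^(m+n) ≤ (4/3)a^g, contradicting d ≥ 2a^g.
    have h1 : a ^ (m + n) * 3 ≤ a ^ g := by
      calc a ^ (m + n) * 3 ≤ a ^ (m + n) * a := Nat.mul_le_mul_left _ ha
        _ = a ^ (m + n + 1) := (pow_succ _ _).symm
        _ ≤ a ^ g := Nat.pow_le_pow_right (by omega) (by omega)
    have h2 : (a : ℤ) ^ (m + n) * 3 ≤ (a : ℤ) ^ g := by exact_mod_cast h1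
    rw [hy] at hle
    linarith

open NumberField in
/-- If `4 a ^ g - b ^ 2 = d = 4 c ^ g - e ^ 2` with `b = u + v` small and `e = u - v`, then the
class group of `ℚ(√-d)` contains `(ℤ/g)²`. -/
theorem exists_injective_classGroup {d g a c : ℕ} {u v : ℤ} (hd : Squarefree d) (hg : 3 ≤ g)
    (hu : 0 < u) (hv : 0 < v) (hba : (u + v) ^ 2 + d = 4 * (a : ℤ) ^ g)
    (hec : (u - v) ^ 2 + d = 4 * (c : ℤ) ^ g) (hbd : (u + v) ^ 2 ≤ d) (ha : 3 ≤ a) (hc : 0 < c)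
    (hca : c ≤ a) (hac : ∀ m n : ℕ, a ^ m = c ^ n → m = 0 ∧ n = 0) :
    ∃ φ : ZMod g × ZMod g →+ Additive (imaginaryQuadraticClassGroup d),
      Function.Injective φ := by
  have hg0 : g ≠ 0 := by omega
  have hcop : ∀ (t : ℤ) (k : ℕ) (x : 𝓞 (imaginaryQuadraticField d)),
      t ^ 2 + d = 4 * (k : ℤ) ^ g → 2 * ringOfIntegersToComplex d x = t + sqrtNeg d →
      IsCoprime x (t - x) ∧ x * (t - x) = (k : 𝓞 (imaginaryQuadraticField d)) ^ g := by
    intro t k x htk hx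
    have hmul : x * (t - x) = (k : 𝓞 (imaginaryQuadraticField d)) ^ g := by
      apply ringOfIntegersToComplex_injective d
      rw [map_mul, map_sub, map_pow, map_intCast, map_natCast]
      have hs := sqrtNeg_sq d
      have h1 : (t : ℂ) ^ 2 + d = 4 * (k : ℂ) ^ g := by exact_mod_cast htk
      have h2 : ringOfIntegersToComplex d x = (t + sqrtNeg d) / 2 := by rw [← hx]; ring
      rw [h2]
      linear_combination h1 / 4 - hs / 4
    refine ⟨?_, hmul⟩
    -- The square of a common prime of k and t would divide d.
    have hcop : IsCoprime ((k : ℤ) ^ g) t := by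
      refine (IsCoprime.pow_left_iff (by omega)).2 ?_
      rw [Int.isCoprime_iff_gcd_eq_one, Int.gcd_eq_natAbs_gcd_natAbs]
      by_contra hne
      obtain ⟨q, hq, hqd⟩ := Nat.exists_prime_and_dvd hne
      have h1 : (q : ℤ) ∣ k := Int.natCast_dvd.2 (hqd.trans (Nat.gcd_dvd_left _ _))
      have h2 : (q : ℤ) ∣ t := Int.natCast_dvd.2 (hqd.trans (Nat.gcd_dvd_right _ _))
      have h3 : (q : ℤ) ^ 2 ∣ d := by
        have h4 : (q : ℤ) ^ 2 ∣ (k : ℤ) ^ g :=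
          (pow_dvd_pow_of_dvd h1 2).trans (pow_dvd_pow _ (by omega))
        rw [show (d : ℤ) = 4 * (k : ℤ) ^ g - t ^ 2 by linarith]
        exact dvd_sub (h4.mul_left _) (pow_dvd_pow_of_dvd h2 2)
      have h4 : q * q ∣ d := by rw [← sq]; exact_mod_cast h3
      exact hq.one_lt.ne' (Nat.isUnit_iff.1 (hd q h4))
    obtain ⟨p, q, hpq⟩ := hcop.map (Int.castRingHom (𝓞 (imaginaryQuadraticField d)))
    simp only [eq_intCast, Int.cast_pow, Int.cast_natCast, ← hmul] at hpq
    -- The Bézout relation between x(t - x) and t is regrouped using t = x + (t - x).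
    exact ⟨p * (t - x) + q, q, by linear_combination hpq⟩
  obtain ⟨α, hα⟩ := exists_ringOfIntegers_two_mul_eq hba
  obtain ⟨β, hβ⟩ := exists_ringOfIntegers_two_mul_eq hec
  -- The conjugate of β is -β', so J' below is the conjugate of J and represents the inverse class.
  -- It turns a relation [I]^m = [J]^n into one of product type.
  obtain ⟨β', hβ'⟩ := exists_ringOfIntegers_two_mul_eq (d := d) (b := v - u) (k := (c : ℤ) ^ g)
    (by linear_combination hec)
  obtain ⟨hαc, hαm⟩ := hcop _ _ _ hba hα
  obtain ⟨hβc, hβm⟩ := hcop _ _ _ hec hβ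
  obtain ⟨hβc', -⟩ := hcop (v - u) c _ (by linear_combination hec) hβ'
  have hββ' : ((u - v : ℤ) : 𝓞 (imaginaryQuadraticField d)) - β = -β' := by
    apply ringOfIntegersToComplex_injective d
    rw [map_sub, map_neg, map_intCast]
    push_cast at hβ hβ' ⊢
    linear_combination -hβ / 2 + hβ' / 2
  obtain ⟨I, I', hI, -, hII'⟩ := exists_ideal_pow_eq_span hg0 hαc hαm
  obtain ⟨J, J', hJ, hJ', hJJ'⟩ := exists_ideal_pow_eq_span hg0 hβc hβm
  rw [hββ', Ideal.span_singleton_neg] at hJ'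
  have hne : ∀ {K L : Ideal (𝓞 (imaginaryQuadraticField d))} {k : ℕ}, k ≠ 0 →
      K * L = Ideal.span {(k : 𝓞 (imaginaryQuadraticField d))} → K ≠ 0 ∧ L ≠ 0 := by
    intro K L k hk h
    rw [← mul_ne_zero_iff, h, Ne, Ideal.zero_eq_bot, Ideal.span_singleton_eq_bot]
    exact_mod_cast hk
  obtain ⟨hI0, -⟩ := hne (by omega) hII'
  obtain ⟨hJ0, hJ0'⟩ := hne hc.ne' hJJ'
  let II : nonZeroDivisors (Ideal (𝓞 (imaginaryQuadraticField d))) :=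
    ⟨I, mem_nonZeroDivisors_of_ne_zero hI0⟩
  let JJ : nonZeroDivisors (Ideal (𝓞 (imaginaryQuadraticField d))) :=
    ⟨J, mem_nonZeroDivisors_of_ne_zero hJ0⟩
  let JJ' : nonZeroDivisors (Ideal (𝓞 (imaginaryQuadraticField d))) :=
    ⟨J', mem_nonZeroDivisors_of_ne_zero hJ0'⟩
  have hone : ∀ {K : nonZeroDivisors (Ideal (𝓞 (imaginaryQuadraticField d)))}
      (x : 𝓞 (imaginaryQuadraticField d)), (K : Ideal _) = Ideal.span {x} →
      ClassGroup.mk0 K = 1 := by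
    intro K x hK
    rw [ClassGroup.mk0_eq_one_iff, hK]
    exact ⟨⟨x, rfl⟩⟩
  have hJinv : ClassGroup.mk0 JJ * ClassGroup.mk0 JJ' = 1 := by
    rw [← map_mul]; exact hone _ hJJ'
  refine exists_injective_zmod_prod (by omega) (ClassGroup.mk0 II) (ClassGroup.mk0 JJ)
    (by rw [← map_pow]; exact hone _ hI) (by rw [← map_pow]; exact hone _ hJ) ?_
  rintro m n hm hn (h | h)
  · rw [← map_pow, ← map_pow, ← map_mul, ClassGroup.mk0_eq_one_iff] at h
    obtain ⟨⟨γ, hγ⟩⟩ := h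
    exact exponents_eq_zero_of_principal hd hg hα hβ hαc hβc hI hJ hγ rfl (Or.inl rfl) hu hv hba
      hec hbd ha hca hm hn (hac m n)
  · have h' : ClassGroup.mk0 II ^ m * ClassGroup.mk0 JJ' ^ n = 1 := by
      rw [h, ← mul_pow, hJinv, one_pow]
    rw [← map_pow, ← map_pow, ← map_mul, ClassGroup.mk0_eq_one_iff] at h'
    obtain ⟨⟨γ, hγ⟩⟩ := h'
    exact exponents_eq_zero_of_principal hd hg hα hβ' hαc hβc' hI hJ' hγ rfl (Or.inr rfl) hu hv hba
      (by linear_combination hec) hbd ha hca hm hn (hac m n)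

/-! ### The parametric family of discriminants -/

/-- The quotient `((C + h) ^ g - C ^ g) / h`. -/
def powDiffQuot {R : Type*} [CommRing R] (g : ℕ) (C h : R) : R :=
  ∑ i ∈ Finset.range g, (C + h) ^ i * C ^ (g - 1 - i)

theorem mul_powDiffQuot {R : Type*} [CommRing R] (g : ℕ) (C h : R) :
    h * powDiffQuot g C h = (C + h) ^ g - C ^ g := by
  rw [← geom_sum₂_mul, powDiffQuot]; ring

/-- The family of discriminants: with `A = C + h`, `u = h r ^ g` and `v = (A ^ g - C ^ g) / h`, it is
both `4 (r A) ^ g - (u + v) ^ 2` and `4 (r C) ^ g - (u - v) ^ 2`. -/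
def discForm {R : Type*} [CommRing R] (g : ℕ) (r C h : R) : R :=
  4 * (r * C) ^ g - (h * r ^ g - powDiffQuot g C h) ^ 2

/-- With u = h r^g and v the quotient, (u+v)^2 - (u-v)^2 = 4uv = 4r^g((C+h)^g - C^g). -/
theorem discForm_eq {R : Type*} [CommRing R] (g : ℕ) (r C h : R) :
    discForm g r C h = 4 * (r * (C + h)) ^ g - (h * r ^ g + powDiffQuot g C h) ^ 2 := by
  rw [discForm, mul_pow, mul_pow]
  linear_combination 4 * r ^ g * mul_powDiffQuot g C h

theorem map_powDiffQuot {R S F : Type*} [CommRing R] [CommRing S] [FunLike F R S]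
    [RingHomClass F R S] (f : F) (g : ℕ) (C h : R) :
    f (powDiffQuot g C h) = powDiffQuot g (f C) (f h) := by
  simp [powDiffQuot, map_sum]

theorem map_discForm {R S F : Type*} [CommRing R] [CommRing S] [FunLike F R S]
    [RingHomClass F R S] (f : F) (g : ℕ) (r C h : R) :
    f (discForm g r C h) = discForm g (f r) (f C) (f h) := by
  simp [discForm, map_powDiffQuot, map_ofNat]

/-- After cancelling the smaller power of r, a power of A divides a power of C, or conversely;
coprimality makes it 1. -/
theorem eq_zero_of_mul_pow_eq {r A C m n : ℕ} (hr : 0 < r) (hAC : A.Coprime C) (hA : 1 < A)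
    (hC : 1 < C) (h : (r * A) ^ m = (r * C) ^ n) : m = 0 ∧ n = 0 := by
  rw [mul_pow, mul_pow] at h
  rcases le_total n m with hmn | hmn
  · obtain ⟨k, rfl⟩ := Nat.exists_eq_add_of_le hmn
    rw [pow_add, mul_assoc] at h
    have h1 := Nat.eq_of_mul_eq_mul_left (pow_pos hr n) h
    have h2 : A ^ (n + k) = 1 :=
      Nat.eq_one_of_dvd_coprimes (Nat.Coprime.pow (n + k) n hAC) dvd_rfl ⟨r ^ k, by rw [← h1]; ring⟩
    have := (Nat.pow_eq_one.1 h2).resolve_left hA.ne'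
    omega
  · obtain ⟨k, rfl⟩ := Nat.exists_eq_add_of_le hmn
    rw [pow_add r, mul_assoc] at h
    have h1 := Nat.eq_of_mul_eq_mul_left (pow_pos hr m) h
    have h2 : C ^ (m + k) = 1 :=
      Nat.eq_one_of_dvd_coprimes (Nat.Coprime.pow m (m + k) hAC) ⟨r ^ k, by rw [h1]; ring⟩ dvd_rfl
    have := (Nat.pow_eq_one.1 h2).resolve_left hC.ne'
    omega

/-- The class group of `ℚ(√-d)` contains `(ℤ/g)²` for a square-free value `d` of the family, if
`u + v` is not too large. -/
theorem exists_injective_of_discForm {g : ℕ} (hg : 3 ≤ g) {r C h : ℕ} (hr : 0 < r) (hC : 1 < C)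
    (hh : 0 < h) {d : ℕ} (hd : (d : ℤ) = discForm g (r : ℤ) C h) (hsq : Squarefree d)
    (hb : (h * (r : ℤ) ^ g + powDiffQuot g (C : ℤ) h) ^ 2 ≤ 2 * (r * (C + h) : ℤ) ^ g) :
    ∃ φ : ZMod g × ZMod g →+ Additive (imaginaryQuadraticClassGroup d),
      Function.Injective φ := by
  have hv : 0 < powDiffQuot g (C : ℤ) h := by
    refine Finset.sum_pos (fun i _ => ?_) ⟨0, Finset.mem_range.2 (by omega)⟩
    have : (0 : ℤ) < C := by omega
    positivity
  have hu : 0 < (h : ℤ) * (r : ℤ) ^ g := by positivity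
  have hd1 := hd
  rw [discForm_eq] at hd1
  rw [discForm] at hd
  -- A prime dividing C + h and C divides h, hence u, v and rC, so its square divides d.
  have hcop : (C + h).Coprime C := by
    by_contra hne
    obtain ⟨q, hq, hqd⟩ := Nat.exists_prime_and_dvd hne
    have h1 : (q : ℤ) ∣ ((C + h : ℕ) : ℤ) := Int.natCast_dvd_natCast.2 (hqd.trans (Nat.gcd_dvd_left _ _))
    have h2 : (q : ℤ) ∣ (C : ℤ) := Int.natCast_dvd_natCast.2 (hqd.trans (Nat.gcd_dvd_right _ _))
    have h3 : (q : ℤ) ∣ h := by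
      have := dvd_sub h1 h2
      push_cast at this
      rwa [add_sub_cancel_left] at this
    have h4 : (q : ℤ) ∣ powDiffQuot g (C : ℤ) h := by
      refine Finset.dvd_sum fun i hi => ?_
      rcases Nat.eq_zero_or_pos i with rfl | hi0
      · exact (dvd_pow h2 (by omega)).mul_left _
      · push_cast at h1
        exact (dvd_pow h1 hi0.ne').mul_right _
    have h5 : (q : ℤ) ^ 2 ∣ d := by
      rw [hd]
      refine dvd_sub (Dvd.dvd.mul_left ?_ _) (pow_dvd_pow_of_dvd (dvd_sub (h3.mul_right _) h4) 2)
      exact (pow_dvd_pow_of_dvd (h2.mul_left _) 2).trans (pow_dvd_pow _ (by omega))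
    have h6 : q * q ∣ d := by rw [← sq]; exact_mod_cast h5
    exact hq.one_lt.ne' (Nat.isUnit_iff.1 (hsq q h6))
  refine exists_injective_classGroup (a := r * (C + h)) (c := r * C) hsq hg hu hv ?_ ?_ ?_ ?_ ?_ ?_
    fun m n hmn => eq_zero_of_mul_pow_eq hr hcop (by omega) hC hmn
  · push_cast; linarith
  · push_cast; linarith
  · linarith
  · nlinarith
  · positivity
  · exact Nat.mul_le_mul_left _ (by omega)

/-! ### Zeros and double roots of the family as a trinomial in r -/

open Polynomial in
/-- The family as a trinomial in `r`. -/
theorem discForm_X_eq {R : Type*} [CommRing R] (g : ℕ) (c h : R) :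
    discForm g (X : R[X]) (C c) (C h) = C (-h ^ 2) * X ^ (2 * g) +
      C (2 * ((c + h) ^ g + c ^ g)) * X ^ g + C (-powDiffQuot g c h ^ 2) := by
  have h1 := mul_powDiffQuot g (C c) (C h)
  rw [discForm, ← map_powDiffQuot (C : R →+* R[X])] at *
  simp only [map_neg, map_mul, map_pow, map_add, map_ofNat]
  linear_combination 2 * X ^ g * h1

open Polynomial in
theorem natDegree_discForm_X_le {R : Type*} [CommRing R] (g : ℕ) (c h : R) :
    (discForm g (X : R[X]) (C c) (C h)).natDegree ≤ 2 * g := by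
  rw [discForm_X_eq]
  refine natDegree_add_le_of_degree_le (natDegree_add_le_of_degree_le ?_ ?_) ?_
  · exact natDegree_C_mul_X_pow_le _ _
  · exact (natDegree_C_mul_X_pow_le _ _).trans (by omega)
  · exact (natDegree_C _).le.trans (Nat.zero_le _)

open Polynomial in
theorem eval_discForm_X {R : Type*} [CommRing R] (g : ℕ) (r c h : R) :
    (discForm g (X : R[X]) (C c) (C h)).eval r = discForm g r c h := by
  rw [← coe_evalRingHom, map_discForm]; simp

open Polynomial in
-- If the leading coefficient -h^2 vanishes, the middle one becomes 4c^g.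
theorem discForm_X_ne_zero {F : Type*} [Field F] {g : ℕ} (hg : g ≠ 0) (h2 : (2 : F) ≠ 0) {c h : F}
    (hch : ¬ (c = 0 ∧ h = 0)) : discForm g (X : F[X]) (C c) (C h) ≠ 0 := by
  intro h0
  rw [discForm_X_eq] at h0
  have key : ∀ a b e : F, C a * X ^ (2 * g) + C b * X ^ g + C e = 0 → a = 0 ∧ b = 0 := by
    intro a b e h
    have e1 := congrArg (fun f => coeff f (2 * g)) h
    have e2 := congrArg (fun f => coeff f g) h
    simp only [coeff_add, coeff_C_mul, coeff_X_pow, coeff_C, hg, show 2 * g ≠ g by omega,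
      show g ≠ 2 * g by omega, show 2 * g ≠ 0 by omega, if_true, if_false, coeff_zero] at e1 e2
    exact ⟨by simpa using e1, by simpa using e2⟩
  obtain ⟨e1, e2⟩ := key _ _ _ h0
  obtain rfl : h = 0 := by simpa using e1
  rw [add_zero, ← two_mul, mul_eq_zero] at e2
  rcases e2 with h | h
  · exact h2 h
  · exact hch ⟨pow_eq_zero_iff hg |>.1 ((mul_eq_zero.1 h).resolve_left h2), rfl⟩

open Polynomial in
-- In w = r^g the form is quadratic, with quarter discriminant (A^g + c^g)^2 - (hk)^2 = 4A^g c^g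
-- because hk = A^g - c^g. A double root thus needs r = 0, which forces k = 0, or A c = 0.
theorem eval_derivative_discForm_X_ne_zero {F : Type*} [Field F] {g : ℕ} (hg : (g : F) ≠ 0)
    (h2 : (2 : F) ≠ 0) {r c h : F} (hc : c ≠ 0) (hch : c + h ≠ 0)
    (hk : powDiffQuot g c h ≠ 0) (h0 : discForm g r c h = 0) :
    (derivative (discForm g (X : F[X]) (C c) (C h))).eval r ≠ 0 := by
  intro hd
  obtain ⟨n, rfl⟩ : ∃ n, g = n + 1 := Nat.exists_eq_succ_of_ne_zero (by rintro rfl; simp at hg)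
  have h1 := mul_powDiffQuot (n + 1) c h
  have e0 := eval_discForm_X (n + 1) r c h
  rw [h0, discForm_X_eq] at e0
  rw [discForm_X_eq] at hd
  set A := c + h
  set k := powDiffQuot (n + 1) c h
  simp only [eval_add, eval_mul, eval_C, eval_pow, eval_X] at e0
  simp only [derivative_add, derivative_C_mul, derivative_C, derivative_X_pow, eval_add, eval_mul,
    eval_C, eval_pow, eval_X, add_zero,
    show 2 * (n + 1) - 1 = n + (n + 1) by omega, Nat.add_sub_cancel] at hd
  have hr : r ≠ 0 := by
    rintro rfl
    simp at e0
    exact hk e0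
  have e3 : ((n + 1 : ℕ) : F) * 2 * r ^ n * (-(h ^ 2 * r ^ (n + 1)) + (A ^ (n + 1) + c ^ (n + 1))) = 0 := by
    rw [← hd]; push_cast; ring
  have e4 := (mul_eq_zero.1 e3).resolve_left (mul_ne_zero (mul_ne_zero hg h2) (pow_ne_zero n hr))
  have e5 : 2 * 2 * (A ^ (n + 1) * c ^ (n + 1)) = 0 := by
    rw [show 2 * (n + 1) = (n + 1) + (n + 1) by omega, pow_add] at e0
    generalize r ^ (n + 1) = w at *
    generalize A ^ (n + 1) = a at *
    generalize c ^ (n + 1) = b at *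
    linear_combination h ^ 2 * e0 + (-h ^ 2 * w + a + b) * e4 + (h * k + (a - b)) * h1
  refine mul_ne_zero (mul_ne_zero h2 h2) (mul_ne_zero (pow_ne_zero _ hch) (pow_ne_zero _ hc)) e5

/-! ### Zeros modulo p² and positivity of the density -/

/-- Reduction from `ℤ/p²` to `ℤ/p`. -/
def zmodSqReduce (p : ℕ) : ZMod (p ^ 2) →+* ZMod p :=
  ZMod.castHom (dvd_pow_self p two_ne_zero) (ZMod p)

theorem zmodSqReduce_eq_zero_iff {p : ℕ} [NeZero p] (x : ZMod (p ^ 2)) :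
    zmodSqReduce p x = 0 ↔ ∃ t, x = p * t := by
  have : NeZero (p ^ 2) := ⟨pow_ne_zero 2 (NeZero.ne p)⟩
  constructor
  · intro h
    rw [← ZMod.natCast_zmod_val x, map_natCast, ZMod.natCast_eq_zero_iff] at h
    obtain ⟨k, hk⟩ := h
    exact ⟨k, by rw [← ZMod.natCast_zmod_val x, hk]; push_cast; rfl⟩
  · rintro ⟨t, rfl⟩
    simp

theorem isUnit_of_zmodSqReduce_ne_zero {p : ℕ} [Fact p.Prime] {x : ZMod (p ^ 2)}
    (h : zmodSqReduce p x ≠ 0) : IsUnit x := by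
  have hp : p.Prime := Fact.out
  have : NeZero (p ^ 2) := ⟨pow_ne_zero 2 hp.ne_zero⟩
  rw [← ZMod.natCast_zmod_val x] at h ⊢
  rw [map_natCast, Ne, ZMod.natCast_eq_zero_iff] at h
  rw [ZMod.isUnit_iff_coprime]
  exact Nat.Coprime.pow_right 2 ((Nat.Prime.coprime_iff_not_dvd hp).2 h).symm

theorem card_zmodSqReduce_fiber_le {p : ℕ} [NeZero p] (y : ZMod p) [NeZero (p ^ 2)] :
    (Finset.univ.filter fun x : ZMod (p ^ 2) => zmodSqReduce p x = y).card ≤ p := by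
  have hp : 0 < p := Nat.pos_of_ne_zero (NeZero.ne p)
  have h : ∀ x : ZMod (p ^ 2), zmodSqReduce p x = y → x.val % p = y.val := by
    rintro x rfl
    conv_rhs => rw [← ZMod.natCast_zmod_val x, map_natCast, ZMod.val_natCast]
  calc _ ≤ (Finset.range p).card := by
        refine Finset.card_le_card_of_injOn (fun x => x.val / p) ?_ ?_
        · intro x _
          have := (ZMod.val_lt x).trans_eq (sq p)
          simp only [Finset.coe_range, Set.mem_Iio]
          exact Nat.div_lt_of_lt_mul this
        · intro x hx x' hx' hxx
          simp only [Finset.coe_filter, Finset.mem_univ, true_and, Set.mem_ofPred_eq] at hx hx' hxx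
          apply ZMod.val_injective
          rw [← Nat.div_add_mod x.val p, ← Nat.div_add_mod x'.val p, hxx, h x hx, h x' hx']
    _ = p := Finset.card_range p

/-- The zeros in `ℤ/p²` of the family as a polynomial in `r`. -/
def discRoots (g p : ℕ) [NeZero (p ^ 2)] (c h : ZMod (p ^ 2)) : Finset (ZMod (p ^ 2)) :=
  Finset.univ.filter fun r => discForm g r c h = 0

theorem card_discForm_zeros_le {F : Type*} [Field F] [Fintype F] [DecidableEq F] {g : ℕ} (hg : g ≠ 0)
    (h2 : (2 : F) ≠ 0) {c h : F} (hch : ¬ (c = 0 ∧ h = 0)) :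
    (Finset.univ.filter fun r : F => discForm g r c h = 0).card ≤ 2 * g := by
  open Polynomial in
  have h0 := discForm_X_ne_zero hg h2 hch
  calc _ ≤ (discForm g (X : F[X]) (C c) (C h)).roots.toFinset.card := by
        refine Finset.card_le_card fun r hr => ?_
        rw [Multiset.mem_toFinset, mem_roots h0, IsRoot, eval_discForm_X]
        exact (Finset.mem_filter.1 hr).2
    _ ≤ _ := Multiset.toFinset_card_le _
    _ ≤ _ := card_roots' _
    _ ≤ 2 * g := natDegree_discForm_X_le g c h

theorem zmodSqReduce_mem_zeros {g p : ℕ} [Fact p.Prime] [NeZero (p ^ 2)] {c h r : ZMod (p ^ 2)}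
    (hr : r ∈ discRoots g p c h) :
    discForm g (zmodSqReduce p r) (zmodSqReduce p c) (zmodSqReduce p h) = 0 := by
  rw [← map_discForm, (Finset.mem_filter.1 hr).2, map_zero]

/-- No simplicity of roots is assumed: each of the at most 2g zeros modulo p may lift to all p
residues above it. -/
theorem card_discRoots_le_mul {g p : ℕ} [Fact p.Prime] [NeZero (p ^ 2)] (hg : g ≠ 0)
    (h2 : (2 : ZMod p) ≠ 0) {c h : ZMod (p ^ 2)}
    (hch : ¬ (zmodSqReduce p c = 0 ∧ zmodSqReduce p h = 0)) :
    (discRoots g p c h).card ≤ p * (2 * g) := by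
  refine (Finset.card_le_mul_card_image_of_maps_to (f := zmodSqReduce p)
    (t := Finset.univ.filter fun r => discForm g r (zmodSqReduce p c) (zmodSqReduce p h) = 0)
    ?_ p ?_).trans (Nat.mul_le_mul_left _ (card_discForm_zeros_le hg h2 hch))
  · intro r hr
    exact Finset.mem_filter.2 ⟨Finset.mem_univ _, zmodSqReduce_mem_zeros hr⟩
  · intro y _
    refine (Finset.card_le_card ?_).trans (card_zmodSqReduce_fiber_le y)
    exact Finset.filter_subset_filter _ (Finset.subset_univ _)

open Polynomial in
-- Away from the bad pairs all zeros modulo p are simple, so each lifts at most once, as in Hensel's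
-- lemma.
theorem card_discRoots_le {g p : ℕ} [Fact p.Prime] [NeZero (p ^ 2)] (hg : (g : ZMod p) ≠ 0)
    (h2 : (2 : ZMod p) ≠ 0) {c h : ZMod (p ^ 2)} (hc : zmodSqReduce p c ≠ 0)
    (hch : zmodSqReduce p c + zmodSqReduce p h ≠ 0)
    (hk : powDiffQuot g (zmodSqReduce p c) (zmodSqReduce p h) ≠ 0) :
    (discRoots g p c h).card ≤ 2 * g := by
  have hg0 : g ≠ 0 := by rintro rfl; simp at hg
  refine (Finset.card_le_card_of_injOn (zmodSqReduce p) (fun r hr => ?_) ?_).trans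
    (card_discForm_zeros_le hg0 h2 (c := zmodSqReduce p c) (h := zmodSqReduce p h) fun h => hc h.1)
  · simpa using zmodSqReduce_mem_zeros (Finset.mem_coe.1 hr)
  · intro r hr r' hr' hrr
    have hz := zmodSqReduce_mem_zeros (Finset.mem_coe.1 hr)
    set f := discForm g (X : (ZMod (p ^ 2))[X]) (C c) (C h) with hf
    have hfr : f.eval r = 0 := by
      rw [hf, eval_discForm_X]; exact (Finset.mem_filter.1 (Finset.mem_coe.1 hr)).2
    have hfr' : f.eval r' = 0 := by
      rw [hf, eval_discForm_X]; exact (Finset.mem_filter.1 (Finset.mem_coe.1 hr')).2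
    obtain ⟨t, ht⟩ := (zmodSqReduce_eq_zero_iff (r' - r)).1 (by rw [map_sub, hrr, sub_self])
    have hu : IsUnit (f.derivative.eval r) := by
      apply isUnit_of_zmodSqReduce_ne_zero
      have h1 := eval_derivative_discForm_X_ne_zero hg h2 hc hch hk hz
      rw [← Polynomial.eval_map_apply, ← derivative_map, hf]
      convert h1 using 4
      rw [← coe_mapRingHom, map_discForm]
      simp
    -- Two lifts differ by a multiple of p, so the quadratic Taylor term dies and the unit
    -- derivative cancels.
    obtain ⟨k, hk⟩ := binomExpansion f r (r' - r)
    have hsq : (r' - r) ^ 2 = 0 := by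
      rw [ht, mul_pow, ← Nat.cast_pow, ZMod.natCast_self, zero_mul]
    rw [add_sub_cancel, hfr, hfr', hsq, mul_zero, add_zero, zero_add] at hk
    exact (sub_eq_zero.1 ((hu.mul_right_eq_zero).1 hk.symm)).symm

open Finset in
theorem card_pow_eq_le {F : Type*} [Field F] [Fintype F] [DecidableEq F] {g : ℕ} (hg : 0 < g) (a c : F) :
    #{h : F | (c + h) ^ g = a} ≤ g := by
  calc _ ≤ #(Polynomial.nthRoots g a).toFinset := by
        refine card_le_card_of_injOn (fun h => c + h) (fun h hh => ?_) (fun x _ y _ h => ?_)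
        · simpa [Polynomial.mem_nthRoots hg] using hh
        · exact add_left_cancel h
    _ ≤ _ := Multiset.toFinset_card_le _
    _ ≤ g := Polynomial.card_nthRoots g a

open Finset in
/-- The pairs `(c, h)` over which the family may have a double root. -/
theorem card_bad_pairs_le {p g : ℕ} [Fact p.Prime] (hg : 0 < g) :
    #{x : ZMod p × ZMod p | x.1 = 0 ∨ x.1 + x.2 = 0 ∨ powDiffQuot g x.1 x.2 = 0} ≤
      p * (g + 2) := by
  classical
  have hcard : #(univ : Finset (ZMod p)) = p := by rw [card_univ, ZMod.card]
  have h1 : #({0} ×ˢ univ : Finset (ZMod p × ZMod p)) = p := by simp [hcard]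
  have h2 : #(univ.image fun c : ZMod p => (c, -c)) ≤ p := card_image_le.trans hcard.le
  have h3 : #(univ.sigma fun c : ZMod p => {h : ZMod p | (c + h) ^ g = c ^ g}) ≤ p * g := by
    rw [card_sigma]
    refine (sum_le_card_nsmul _ _ g fun c _ => card_pow_eq_le hg _ _).trans ?_
    rw [hcard, smul_eq_mul]
  have h4 : ({x : ZMod p × ZMod p | x.1 = 0 ∨ x.1 + x.2 = 0 ∨ powDiffQuot g x.1 x.2 = 0} :
      Finset _) ⊆ ({0} ×ˢ univ ∪ univ.image fun c : ZMod p => (c, -c)) ∪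
        (univ.sigma fun c : ZMod p => {h : ZMod p | (c + h) ^ g = c ^ g}).image
          fun s => (s.1, s.2) := by
    rintro ⟨c, h⟩ hx
    simp only [mem_filter, mem_univ, true_and] at hx
    simp only [mem_union, mem_product, mem_singleton, mem_univ, and_true, mem_image, true_and,
      Prod.mk.injEq, mem_sigma, mem_filter, Sigma.exists]
    rcases hx with hx | hx | hx
    · exact Or.inl (Or.inl hx)
    · exact Or.inl (Or.inr ⟨c, rfl, (eq_neg_of_add_eq_zero_right hx).symm⟩)
    · refine Or.inr ⟨c, h, ?_, rfl, rfl⟩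
      have := mul_powDiffQuot g c h
      rw [hx, mul_zero] at this
      exact (sub_eq_zero.1 this.symm)
  have h5 := card_image_le (s := univ.sigma fun c : ZMod p => ({h : ZMod p | (c + h) ^ g = c ^ g} : Finset _))
    (f := fun s => ((s.1, s.2) : ZMod p × ZMod p))
  have h6 := (card_le_card h4).trans ((card_union_le _ _).trans
    (add_le_add (card_union_le _ _) le_rfl))
  rw [h1] at h6
  linarith

open Finset in
/-- The number of pairs modulo `p²` whose reduction lies in a given set. -/
theorem card_filter_reduce_mem_le {p : ℕ} [NeZero p] [NeZero (p ^ 2)] (S : Finset (ZMod p × ZMod p)) :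
    #(univ.filter fun x : ZMod (p ^ 2) × ZMod (p ^ 2) =>
      (zmodSqReduce p x.1, zmodSqReduce p x.2) ∈ S) ≤
      p ^ 2 * #S := by
  refine card_le_mul_card_image_of_maps_to
    (f := fun x : ZMod (p ^ 2) × ZMod (p ^ 2) => (zmodSqReduce p x.1, zmodSqReduce p x.2)) (fun x hx => (mem_filter.1 hx).2) _ ?_
  rintro ⟨y, z⟩ _
  calc _ ≤ #(({x | zmodSqReduce p x = y} : Finset (ZMod (p ^ 2))) ×ˢ
        ({x | zmodSqReduce p x = z} : Finset (ZMod (p ^ 2)))) := by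
        refine card_le_card fun x hx => ?_
        have := (mem_filter.1 hx).2
        simp only [Prod.mk.injEq] at this
        simpa using this
    _ ≤ p * p := by
        rw [card_product]
        exact Nat.mul_le_mul (card_zmodSqReduce_fiber_le y) (card_zmodSqReduce_fiber_le z)
    _ = p ^ 2 := (sq p).symm

open Finset in
-- The p^4 pairs carry at most 2g zeros each, apart from (g+2)p^3 bad pairs with at most 2gp zeros
-- and the p^2 pairs above (0, 0) with at most p^2.
theorem sum_card_discRoots_le {g p : ℕ} [Fact p.Prime] [NeZero (p ^ 2)] (hg : (g : ZMod p) ≠ 0)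
    (h2 : (2 : ZMod p) ≠ 0) :
    ∑ x : ZMod (p ^ 2) × ZMod (p ^ 2), #(discRoots g p x.1 x.2) ≤
      (2 * g + 2 * g * (g + 2) + 1) * p ^ 4 := by
  have hg0 : g ≠ 0 := by rintro rfl; simp at hg
  set bad : Finset (ZMod p × ZMod p) :=
    {x | x.1 = 0 ∨ x.1 + x.2 = 0 ∨ powDiffQuot g x.1 x.2 = 0} with hbad
  have hcard : #(univ : Finset (ZMod (p ^ 2))) = p ^ 2 := by rw [card_univ, ZMod.card]
  have hpt : ∀ x : ZMod (p ^ 2) × ZMod (p ^ 2), #(discRoots g p x.1 x.2) ≤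
      2 * g + (if (zmodSqReduce p x.1, zmodSqReduce p x.2) ∈ bad then p * (2 * g) else 0) +
      (if (zmodSqReduce p x.1, zmodSqReduce p x.2) ∈ ({0} : Finset _) then p ^ 2 else 0) := by
    rintro ⟨c, h⟩
    by_cases h0 : (zmodSqReduce p c, zmodSqReduce p h) ∈ ({0} : Finset (ZMod p × ZMod p))
    · rw [if_pos h0]
      exact ((card_le_univ _).trans (by rw [ZMod.card])).trans (Nat.le_add_left _ _)
    have h0' : ¬ (zmodSqReduce p c = 0 ∧ zmodSqReduce p h = 0) := by
      simpa [Prod.ext_iff] using h0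
    rw [if_neg h0, add_zero]
    by_cases h1 : (zmodSqReduce p c, zmodSqReduce p h) ∈ bad
    · rw [if_pos h1]
      exact (card_discRoots_le_mul hg0 h2 h0').trans (Nat.le_add_left _ _)
    · rw [if_neg h1, add_zero]
      simp only [hbad, mem_filter, mem_univ, true_and, not_or] at h1
      exact card_discRoots_le hg h2 h1.1 h1.2.1 h1.2.2
  refine (sum_le_sum fun x _ => hpt x).trans ?_
  rw [sum_add_distrib, sum_add_distrib, ← sum_filter, ← sum_filter, sum_const, sum_const, sum_const,
    smul_eq_mul, smul_eq_mul, smul_eq_mul]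
  have e1 := card_filter_reduce_mem_le bad
  have e2 := card_filter_reduce_mem_le (p := p) {0}
  have e3 : #bad ≤ p * (g + 2) := card_bad_pairs_le (Nat.pos_of_ne_zero hg0)
  have e4 : #(univ : Finset (ZMod (p ^ 2) × ZMod (p ^ 2))) = p ^ 2 * p ^ 2 := by
    rw [← univ_product_univ, card_product, hcard]
  rw [card_singleton, mul_one] at e2
  rw [e4]
  calc _ ≤ p ^ 2 * p ^ 2 * (2 * g) + p ^ 2 * (p * (g + 2)) * (p * (2 * g)) + p ^ 2 * p ^ 2 := by
        gcongr
        exact e1.trans (Nat.mul_le_mul_left _ e3)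
    _ = _ := by ring

/-- The family as a polynomial in `(r, C, h)`. -/
noncomputable def discPoly (g : ℕ) : MvPolynomial (Fin 3) ℤ :=
  discForm g (MvPolynomial.X 0) (MvPolynomial.X 1) (MvPolynomial.X 2)

theorem aeval_discPoly {R : Type*} [CommRing R] [Algebra ℤ R] (g : ℕ) (x : Fin 3 → R) :
    MvPolynomial.aeval x (discPoly g) = discForm g (x 0) (x 1) (x 2) := by
  rw [discPoly, map_discForm]; simp

theorem eval_discPoly (g : ℕ) (x : Fin 3 → ℤ) :
    MvPolynomial.eval x (discPoly g) = discForm g (x 0) (x 1) (x 2) := by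
  rw [discPoly, map_discForm]; simp

theorem powDiffQuot_zero_one {R : Type*} [CommRing R] {g : ℕ} (hg : g ≠ 0) :
    powDiffQuot g (0 : R) 1 = 1 := by
  have := mul_powDiffQuot g (0 : R) 1
  simpa [hg] using this

theorem discForm_zero_zero_one {R : Type*} [CommRing R] {g : ℕ} (hg : g ≠ 0) :
    discForm g (0 : R) 0 1 = -1 := by
  simp [discForm, powDiffQuot_zero_one hg, hg]

/-- Setting r = C = 0 leaves -h^(2g-2). -/
theorem two_le_totalDegree_discPoly {g : ℕ} (hg : 2 ≤ g) : 2 ≤ (discPoly g).totalDegree := by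
  have h := MvPolynomial.aeval_natDegree_le (m := (discPoly g).totalDegree) (n := 1) (discPoly g) le_rfl
    ![(0 : Polynomial ℤ), 0, Polynomial.X] (by intro i; fin_cases i <;> simp)
  rw [aeval_discPoly] at h
  have h1 : powDiffQuot g (0 : Polynomial ℤ) Polynomial.X = Polynomial.X ^ (g - 1) := by
    have := mul_powDiffQuot g (0 : Polynomial ℤ) Polynomial.X
    rw [zero_add, zero_pow (by omega), sub_zero,
      show Polynomial.X ^ g = (Polynomial.X : Polynomial ℤ) * Polynomial.X ^ (g - 1) by
        rw [← pow_succ', Nat.sub_add_cancel (by omega)]] at this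
    exact mul_left_cancel₀ Polynomial.X_ne_zero this
  have h2 : discForm g (0 : Polynomial ℤ) 0 Polynomial.X = -Polynomial.X ^ ((g - 1) * 2) := by
    rw [discForm, h1, pow_mul]
    simp [show g ≠ 0 by omega]
  simp only [Matrix.cons_val_zero, Matrix.cons_val_one, Matrix.cons_val] at h
  rw [h2, Polynomial.natDegree_neg, Polynomial.natDegree_X_pow] at h
  omega

open Finset in
theorem rootCountMod_discPoly {g p : ℕ} [NeZero (p ^ 2)] :
    rootCountMod (discPoly g) (p ^ 2) ≤
      ∑ x : ZMod (p ^ 2) × ZMod (p ^ 2), #(discRoots g p x.1 x.2) := by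
  rw [← card_sigma, rootCountMod, ← Nat.card_eq_finsetCard]
  refine Nat.card_le_card_of_injective
    (fun x => ⟨⟨(x.1 1, x.1 2), x.1 0⟩, ?_⟩) fun x y hxy => ?_
  · rw [mem_sigma]
    refine ⟨mem_univ _, mem_filter.2 ⟨mem_univ _, ?_⟩⟩
    rw [← aeval_discPoly]; exact x.2
  · simp only [Subtype.mk.injEq, Sigma.mk.injEq, Prod.mk.injEq, heq_eq_eq] at hxy
    apply Subtype.ext
    funext i
    fin_cases i
    · exact hxy.2
    · exact hxy.1.1
    · exact hxy.1.2

/-- At (r, C, h) = (0, 0, 1) the value is -1, nonzero modulo every p^2. -/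
theorem rootCountMod_lt {g p : ℕ} (hg : g ≠ 0) (hp : p.Prime) :
    rootCountMod (discPoly g) (p ^ 2) < p ^ (2 * 3) := by
  have : NeZero (p ^ 2) := ⟨pow_ne_zero 2 hp.ne_zero⟩
  have : Fact (1 < p ^ 2) := ⟨Nat.one_lt_pow two_ne_zero hp.one_lt⟩
  have h : Nat.card (Fin 3 → ZMod (p ^ 2)) = p ^ (2 * 3) := by
    simp [Nat.card_eq_fintype_card, ZMod.card, ← pow_mul]
  rw [← h, rootCountMod]
  refine Finite.card_subtype_lt (x := ![0, 0, 1]) ?_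
  rw [aeval_discPoly]
  simp only [Matrix.cons_val_zero, Matrix.cons_val_one, Matrix.cons_val]
  rw [discForm_zero_zero_one hg]
  exact neg_ne_zero.2 one_ne_zero

theorem exists_rootCountMod_le {g : ℕ} (hg : 3 ≤ g) :
    ∃ K : ℕ, ∀ p : ℕ, p.Prime → rootCountMod (discPoly g) (p ^ 2) ≤ K * p ^ 4 := by
  -- The term g^2 absorbs the primes p ≤ g, where p^6 ≤ g^2 p^4; for p > g both g and 2 are
  -- invertible.
  refine ⟨(2 * g + 2 * g * (g + 2) + 1) + g ^ 2, fun p hp => ?_⟩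
  have : NeZero (p ^ 2) := ⟨pow_ne_zero 2 hp.ne_zero⟩
  have : Fact p.Prime := ⟨hp⟩
  rcases lt_or_ge g p with h | h
  · refine rootCountMod_discPoly.trans ((sum_card_discRoots_le ?_ ?_).trans ?_)
    · rw [Ne, ZMod.natCast_eq_zero_iff]
      exact Nat.not_dvd_of_pos_of_lt (by omega) h
    · have : ((2 : ℕ) : ZMod p) ≠ 0 := by
        rw [Ne, ZMod.natCast_eq_zero_iff]
        exact Nat.not_dvd_of_pos_of_lt (by omega) (by omega)
      exact_mod_cast this
    · exact Nat.mul_le_mul_right _ (Nat.le_add_right _ _)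
  · calc _ ≤ p ^ (2 * 3) := (rootCountMod_lt (by omega) hp).le
      _ = p ^ 2 * p ^ 4 := by ring
      _ ≤ _ := Nat.mul_le_mul_right _ ((Nat.pow_le_pow_left h 2).trans (Nat.le_add_left _ _))

/-- The factors are positive and equal 1 - O(p^(-2)), so their logarithms are summable. -/
theorem squarefreeDensity_discPoly_pos {g : ℕ} (hg : 3 ≤ g) :
    0 < squarefreeDensity (discPoly g) := by
  obtain ⟨K, hK⟩ := exists_rootCountMod_le hg
  have hpos : ∀ p : Nat.Primes, 0 < localSquarefreeDensity (discPoly g) p := by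
    intro p
    have h1 : (0 : ℝ) < ((p : ℕ) : ℝ) ^ (2 * 3) := pow_pos (by exact_mod_cast p.2.pos) _
    have h2 : (rootCountMod (discPoly g) ((p : ℕ) ^ 2) : ℝ) < ((p : ℕ) : ℝ) ^ (2 * 3) := by
      exact_mod_cast rootCountMod_lt (by omega) p.2
    rw [localSquarefreeDensity, sub_pos, div_lt_one h1]
    exact h2
  have hsum : Summable fun p : Nat.Primes => localSquarefreeDensity (discPoly g) p - 1 := by
    have h1 : Summable fun p : Nat.Primes => (K : ℝ) * (((p : ℕ) : ℝ) ^ 2)⁻¹ :=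
      ((Real.summable_nat_pow_inv.2 one_lt_two).comp_injective Nat.Primes.coe_nat_injective).mul_left _
    refine Summable.of_norm_bounded h1 fun p => ?_
    have h2 : (0 : ℝ) < ((p : ℕ) : ℝ) := by exact_mod_cast p.2.pos
    have h3 : (rootCountMod (discPoly g) ((p : ℕ) ^ 2) : ℝ) ≤ K * ((p : ℕ) : ℝ) ^ 4 := by
      exact_mod_cast hK p p.2
    rw [localSquarefreeDensity, sub_sub_cancel_left, norm_neg, Real.norm_of_nonneg (by positivity),
      div_le_iff₀ (by positivity)]
    refine h3.trans (le_of_eq ?_)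
    field_simp
  have hlog := Real.summable_log_one_add_of_summable hsum
  simp only [add_sub_cancel] at hlog
  rw [squarefreeDensity, ← Real.rexp_tsum_eq_tprod hpos hlog]
  exact Real.exp_pos _

/-! ### The divisor bound -/

/-- Bernoulli's inequality in both cases: p^δ ≥ 2 for large p, and p^δ ≥ 1 + t with t = 2^δ - 1 for
small p, at the cost of a factor 1 + 1/t. -/
theorem add_one_le_mul_rpow {δ : ℝ} (hδ : 0 < δ) {p : ℕ} (hp : 2 ≤ p) (k : ℕ) :
    ((k : ℝ) + 1) ≤ (if (p : ℝ) < 2 ^ (1 / δ) then 1 + 1 / ((2 : ℝ) ^ δ - 1) else 1) *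
      ((p : ℝ) ^ k) ^ δ := by
  have hp' : (2 : ℝ) ≤ p := by exact_mod_cast hp
  have h0 : ((p : ℝ) ^ k) ^ δ = ((p : ℝ) ^ δ) ^ k := by
    rw [← Real.rpow_natCast, ← Real.rpow_natCast, ← Real.rpow_mul (by linarith),
      ← Real.rpow_mul (by linarith), mul_comm]
  rw [h0]
  split_ifs with h
  · set t : ℝ := (2 : ℝ) ^ δ - 1 with ht
    have htpos : 0 < t := sub_pos.2 (Real.one_lt_rpow one_lt_two hδ)
    have h1 : 1 + t ≤ (p : ℝ) ^ δ := by
      rw [ht, add_sub_cancel]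
      exact Real.rpow_le_rpow (by norm_num) hp' hδ.le
    have h2 : 1 + (k : ℝ) * t ≤ ((p : ℝ) ^ δ) ^ k :=
      (one_add_mul_le_pow (by linarith) k).trans (pow_le_pow_left₀ (by linarith) h1 k)
    calc (k : ℝ) + 1 ≤ (1 + 1 / t) * (1 + k * t) := by
          have : (1 + 1 / t) * (1 + k * t) = k + 1 + k * t + 1 / t := by field_simp; ring
          rw [this]
          have : 0 ≤ (k : ℝ) * t := by positivity
          have : 0 ≤ 1 / t := by positivity
          linarith
      _ ≤ _ := mul_le_mul_of_nonneg_left h2 (by positivity)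
  · rw [one_mul]
    have h1 : (1 : ℝ) + 1 ≤ (p : ℝ) ^ δ := by
      calc (1 : ℝ) + 1 = (2 ^ (1 / δ)) ^ δ := by
            rw [← Real.rpow_mul (by norm_num), one_div_mul_cancel hδ.ne', Real.rpow_one]; norm_num
        _ ≤ _ := Real.rpow_le_rpow (by positivity) (not_lt.1 h) hδ.le
    have h2 := (one_add_mul_le_pow (a := (1 : ℝ)) (by norm_num) k).trans
      (pow_le_pow_left₀ (by norm_num) h1 k)
    linarith

/-- The divisor bound. -/
theorem exists_card_divisors_le {δ : ℝ} (hδ : 0 < δ) :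
    ∃ K : ℝ, 1 ≤ K ∧ ∀ n : ℕ, n ≠ 0 → (n.divisors.card : ℝ) ≤ K * (n : ℝ) ^ δ := by
  set D : ℝ := 1 + 1 / ((2 : ℝ) ^ δ - 1) with hD
  have hD1 : 1 ≤ D := by
    have : 0 < (2 : ℝ) ^ δ - 1 := sub_pos.2 (Real.one_lt_rpow one_lt_two hδ)
    rw [hD, le_add_iff_nonneg_right]
    positivity
  set Y : ℕ := ⌈(2 : ℝ) ^ (1 / δ)⌉₊ with hY
  refine ⟨D ^ Y, one_le_pow₀ hD1, fun n hn => ?_⟩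
  have h1 : (n.divisors.card : ℝ) = ∏ p ∈ n.primeFactors, ((n.factorization p : ℝ) + 1) := by
    rw [Nat.card_divisors hn]; push_cast; rfl
  have h2 : (n : ℝ) ^ δ = ∏ p ∈ n.primeFactors, ((p : ℝ) ^ n.factorization p) ^ δ := by
    rw [Real.finsetProd_rpow _ _ fun p _ => by positivity]
    congr 1
    conv_lhs => rw [← Nat.prod_factorization_pow_eq_self hn]
    rw [Finsupp.prod]; push_cast; rfl
  rw [h1, h2]
  calc _ ≤ ∏ p ∈ n.primeFactors, ((if (p : ℝ) < 2 ^ (1 / δ) then D else 1) *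
        ((p : ℝ) ^ n.factorization p) ^ δ) :=
        Finset.prod_le_prod (fun p _ => by positivity) fun p hp =>
          add_one_le_mul_rpow hδ (Nat.prime_of_mem_primeFactors hp).two_le _
    _ = (∏ p ∈ n.primeFactors, if (p : ℝ) < 2 ^ (1 / δ) then D else 1) * _ :=
        Finset.prod_mul_distrib
    _ ≤ _ := by
        refine mul_le_mul_of_nonneg_right ?_ (Finset.prod_nonneg fun p _ => by positivity)
        -- Only primes below 2^(1/δ) contribute a factor D, and there are at most Y of them.
        rw [← Finset.prod_filter, Finset.prod_const]
        refine pow_le_pow_right₀ hD1 ?_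
        calc _ ≤ (Finset.range Y).card := Finset.card_le_card fun p hp => by
              rw [Finset.mem_range]
              exact Nat.lt_ceil.2 (Finset.mem_filter.1 hp).2
          _ = Y := Finset.card_range Y

/-! ### Square-free values in boxes away from the axes -/

open Filter in
/-- The conjecture, localized to the boxes `∏ (B j, 4 B j]`. -/
theorem exists_card_box_ge (hconj : SquarefreeDensityConjecture) {P : MvPolynomial (Fin 3) ℤ}
    (hP : 2 ≤ P.totalDegree) (hpos : 0 < squarefreeDensity P) :
    ∃ B₀ : ℝ, ∀ B : Fin 3 → ℝ, (∀ j, B₀ ≤ B j) →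
      squarefreeDensity P * ∏ j, B j ≤ (Set.ncard {x : Fin 3 → ℤ |
        (∀ j, B j < x j ∧ (x j : ℝ) ≤ 4 * B j) ∧ Squarefree (MvPolynomial.eval x P)} : ℝ) := by
  have h := Metric.tendsto_atTop.1 (hconj 3 P hP) (squarefreeDensity P / 16) (by positivity)
  obtain ⟨B₁, hB₁⟩ := h
  set δ := squarefreeDensity P with hδ
  set b : ℝ := max 1 (max (B₁ 0) (max (B₁ 1) (B₁ 2))) with hb
  have hb1 : 1 ≤ b := le_max_left _ _
  have hbB : ∀ j, B₁ j ≤ b := by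
    intro j; fin_cases j <;> simp [hb]
  refine ⟨b, fun B hB => ?_⟩
  have hfin : ∀ D : Fin 3 → ℝ, {x : Fin 3 → ℤ | ∀ j, 0 ≤ x j ∧ (x j : ℝ) ≤ D j}.Finite := by
    intro D
    refine (Set.Finite.pi' fun j => Set.finite_Icc (0 : ℤ) ⌊D j⌋).subset fun x hx j => ?_
    exact ⟨(hx j).1, Int.le_floor.2 (hx j).2⟩
  have hBpos : ∀ j, 0 < B j := fun j => by linarith [hB j]
  have hprod : 0 < ∏ j, B j := Finset.prod_pos fun j _ => hBpos j
  have hcount : ∀ D : Fin 3 → ℝ, (∀ j, B j ≤ D j) →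
      |(squarefreeValueCount P D : ℝ) - δ * ∏ j, D j| < δ / 16 * ∏ j, D j := by
    intro D hD
    have hDpos : 0 < ∏ j, D j := Finset.prod_pos fun j _ => (hBpos j).trans_le (hD j)
    have h1 := hB₁ D fun j => (hbB j).trans ((hB j).trans (hD j))
    rw [Real.dist_eq] at h1
    have h2 : (squarefreeValueCount P D : ℝ) - δ * ∏ j, D j =
        (squarefreeValueCount P D / ∏ j, D j - δ) * ∏ j, D j := by field_simp
    rw [h2, abs_mul, abs_of_pos hDpos]
    exact mul_lt_mul_of_pos_right h1 hDpos
  set S : Set (Fin 3 → ℤ) := {x : Fin 3 → ℤ |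
        (∀ j, B j < x j ∧ (x j : ℝ) ≤ 4 * B j) ∧ Squarefree (MvPolynomial.eval x P)} with hS
  set V : (Fin 3 → ℝ) → Set (Fin 3 → ℤ) := fun D => {x : Fin 3 → ℤ |
    (∀ j, 0 ≤ x j ∧ (x j : ℝ) ≤ D j) ∧ Squarefree (MvPolynomial.eval x P)} with hV
  have hVfin : ∀ D, (V D).Finite := fun D => (hfin D).subset fun x hx => hx.1
  -- A point of the large box outside `S` has some coordinate i at most B i, so it lies in the box
  -- with that side shortened.
  set E : Fin 3 → Fin 3 → ℝ := fun i => Function.update (fun j => 4 * B j) i (B i) with hE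
  have hsub : V (fun j => 4 * B j) ⊆ S ∪ (V (E 0) ∪ (V (E 1) ∪ V (E 2))) := by
    intro x hx
    by_cases hx' : ∀ j, B j < x j
    · exact Or.inl ⟨fun j => ⟨hx' j, (hx.1 j).2⟩, hx.2⟩
    · push Not at hx'
      obtain ⟨i, hi⟩ := hx'
      have hmem : x ∈ V (E i) := by
        refine ⟨fun j => ⟨(hx.1 j).1, ?_⟩, hx.2⟩
        by_cases hj : j = i
        · subst hj; simpa [hE] using hi
        · simpa [hE, hj] using (hx.1 j).2
      right
      fin_cases i
      · exact Or.inl hmem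
      · exact Or.inr (Or.inl hmem)
      · exact Or.inr (Or.inr hmem)
  have hSfin : S.Finite := (hVfin (fun j => 4 * B j)).subset fun x hx =>
    ⟨fun j => ⟨by have := (hBpos j).trans (hx.1 j).1; exact_mod_cast this.le, (hx.1 j).2⟩, hx.2⟩
  have hc : squarefreeValueCount P (fun j => 4 * B j) ≤ S.ncard + (squarefreeValueCount P (E 0) +
      (squarefreeValueCount P (E 1) + squarefreeValueCount P (E 2))) := by
    refine (Set.ncard_le_ncard hsub (hSfin.union ((hVfin _).union ((hVfin _).union (hVfin _))))).trans ?_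
    refine (Set.ncard_union_le _ _).trans (Nat.add_le_add_left ?_ _)
    refine (Set.ncard_union_le _ _).trans (Nat.add_le_add_left ?_ _)
    exact Set.ncard_union_le _ _
  have hc' : (squarefreeValueCount P (fun j => 4 * B j) : ℝ) ≤ S.ncard +
      (squarefreeValueCount P (E 0) + (squarefreeValueCount P (E 1) +
        squarefreeValueCount P (E 2))) := by exact_mod_cast hc
  have hEp : ∀ i, ∏ j, E i j = 16 * ∏ j, B j := by
    intro i
    fin_cases i <;> simp [hE, Fin.prod_univ_three, Function.update] <;> ring
  have h4 : ∏ j, 4 * B j = 64 * ∏ j, B j := by simp [Fin.prod_univ_three]; ring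
  have hEB : ∀ i j, B j ≤ E i j := by
    intro i j
    by_cases hj : j = i
    · subst hj; simp [hE]
    · simp [hE, hj]; linarith [hBpos j]
  have hm := hcount (fun j => 4 * B j) fun j => by linarith [hBpos j]
  have hn := fun i => hcount (E i) (hEB i)
  simp only [h4, hEp, abs_lt] at hm hn
  have := (hn 0).2
  have := (hn 1).2
  have := (hn 2).2
  have := hm.1
  -- With V = ∏ B j and relative error 1/16, at least (64 - 4)δV - 3(16 + 1)δV = 9δV points remain.
  -- The ratio 4 matters: λ^3 > 3λ^2 requires λ > 3.
  nlinarith [mul_pos hpos hprod]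

/-! ### Counting coincidences in the family -/

open Finset in
/-- Cauchy–Schwarz: a map with few coincidences has a large image. -/
theorem card_sq_le_card_image_mul {α β : Type*} [DecidableEq β] (S : Finset α) (f : α → β) :
    #S ^ 2 ≤ #(S.image f) * #((S ×ˢ S).filter fun x => f x.1 = f x.2) := by
  classical
  have h1 : #S = ∑ b ∈ S.image f, #{x ∈ S | f x = b} :=
    card_eq_sum_card_fiberwise fun x hx => mem_image_of_mem f hx
  have h2 : #((S ×ˢ S).filter fun x => f x.1 = f x.2) =
      ∑ b ∈ S.image f, #{x ∈ S | f x = b} ^ 2 := by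
    rw [card_eq_sum_card_fiberwise (f := fun x => f x.1) (t := S.image f) fun x hx =>
      mem_image_of_mem f (mem_product.1 (mem_filter.1 hx).1).1]
    refine sum_congr rfl fun b _ => ?_
    rw [sq, ← card_product]
    congr 1
    ext ⟨x, y⟩
    simp only [mem_filter, mem_product]
    constructor
    · rintro ⟨⟨⟨hx, hy⟩, h⟩, rfl⟩; exact ⟨⟨hx, rfl⟩, hy, h.symm⟩
    · rintro ⟨⟨hx, rfl⟩, hy, h⟩; exact ⟨⟨⟨hx, hy⟩, h.symm⟩, rfl⟩
  rw [h2, h1]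
  exact sq_sum_le_card_mul_sum_sq

/-- The difference `u - v` of the two parameters of a member of the family. -/
def discDiff (g : ℕ) (s : Fin 3 → ℤ) : ℤ := s 2 * s 0 ^ g - powDiffQuot g (s 1) (s 2)

theorem discForm_eq_discDiff (g : ℕ) (s : Fin 3 → ℤ) :
    discForm g (s 0) (s 1) (s 2) = 4 * (s 0 * s 1) ^ g - discDiff g s ^ 2 := rfl

open Finset Polynomial in
-- Multiplying e = h r^g - ((c+h)^g - c^g)/h by h shows that h is a root of a polynomial which is
-- monic of degree g, because g ≥ 3.
theorem card_discDiff_eq_le {g : ℕ} (hg : 3 ≤ g) (S : Finset (Fin 3 → ℤ)) (r c e : ℤ) :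
    #{s ∈ S | s 0 = r ∧ s 1 = c ∧ discDiff g s = e} ≤ g := by
  set q : ℤ[X] := (X + C c) ^ g + (-(C (r ^ g) * X ^ 2) + C e * X - C (c ^ g)) with hq
  have hdeg : ((X + C c) ^ g : ℤ[X]).degree = g := by
    rw [degree_pow, degree_X_add_C, nsmul_eq_mul, mul_one]
  have hmonic : q.Monic := by
    refine Monic.add_of_left ((monic_X_add_C c).pow g) ?_
    rw [hdeg]
    refine lt_of_le_of_lt (b := ((2 : ℕ) : WithBot ℕ)) ?_ (by exact_mod_cast hg)
    refine natDegree_le_iff_degree_le.1 ?_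
    compute_degree
  have hnat : q.natDegree ≤ g := by
    refine natDegree_add_le_of_degree_le (natDegree_le_of_degree_le hdeg.le) ?_
    refine le_trans ?_ (show 2 ≤ g by omega)
    compute_degree
  calc _ ≤ #q.roots.toFinset := by
        refine card_le_card_of_injOn (fun s => s 2) (fun s hs => ?_) (fun s hs s' hs' h => ?_)
        · obtain ⟨-, h0, h1, h2⟩ := mem_filter.1 (mem_coe.1 hs)
          rw [mem_coe, Multiset.mem_toFinset, mem_roots hmonic.ne_zero, IsRoot, hq]
          simp only [eval_add, eval_sub, eval_neg, eval_mul, eval_pow, eval_X, eval_C]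
          have h3 := mul_powDiffQuot g (s 1) (s 2)
          rw [discDiff, h0, h1] at h2
          rw [h1] at h3
          linear_combination -h3 - s 2 * h2
        · obtain ⟨-, h0, h1, -⟩ := mem_filter.1 (mem_coe.1 hs)
          obtain ⟨-, h0', h1', -⟩ := mem_filter.1 (mem_coe.1 hs')
          funext i
          fin_cases i
          · exact h0.trans h0'.symm
          · exact h1.trans h1'.symm
          · exact h
    _ ≤ _ := Multiset.toFinset_card_le _
    _ ≤ _ := card_roots' _
    _ ≤ g := hnat

open Finset in
-- r is a divisor of c, and it determines C; then at most g values of h remain.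
theorem card_fiber_le {g T : ℕ} (hg : 3 ≤ g) {S : Finset (Fin 3 → ℤ)} {c : ℤ} (hc : c ≠ 0)
    (hT : #c.natAbs.divisors ≤ T) (hS : ∀ s ∈ S, 0 < s 0) (e : ℤ) :
    #{s ∈ S | s 0 * s 1 = c ∧ discDiff g s = e} ≤ g * T := by
  refine (card_le_mul_card_image_of_maps_to (f := fun s => (s 0).natAbs) (t := c.natAbs.divisors)
    (fun s hs => ?_) g fun b _ => ?_).trans (Nat.mul_le_mul_left _ hT)
  · obtain ⟨-, h, -⟩ := mem_filter.1 hs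
    rw [Nat.mem_divisors]
    exact ⟨Int.natAbs_dvd_natAbs.2 ⟨_, h.symm⟩, Int.natAbs_ne_zero.2 hc⟩
  · refine (card_le_card fun s hs => ?_).trans (card_discDiff_eq_le hg S b (c / b) e)
    obtain ⟨hs1, hs2⟩ := mem_filter.1 hs
    obtain ⟨hs3, hs4, hs5⟩ := mem_filter.1 hs1
    have h0 := hS s hs3
    have hb : s 0 = b := by rw [← hs2]; omega
    refine mem_filter.2 ⟨hs3, hb, ?_, hs5⟩
    rw [← hs4, ← hb, Int.mul_ediv_cancel_left _ h0.ne']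

open Finset in
theorem card_int_dvd_le {T : ℕ} {n : ℤ} (hT : #n.natAbs.divisors ≤ T) :
    #(n.natAbs.divisors.image (fun k : ℕ => (k : ℤ)) ∪
      n.natAbs.divisors.image (fun k : ℕ => -(k : ℤ))) ≤ 2 * T := by
  refine (card_union_le _ _).trans ?_
  have := card_image_le (s := n.natAbs.divisors) (f := fun k : ℕ => (k : ℤ))
  have := card_image_le (s := n.natAbs.divisors) (f := fun k : ℕ => -(k : ℤ))
  omega

open Finset in
/-- Coincidences in the family are rare: for given distinct values `c`, `c'` of `r C` they come
from factorizations of `4 (c ^ g - c' ^ g)`. -/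
theorem card_discForm_eq_le {g T Z : ℕ} (hg : 3 ≤ g) {S : Finset (Fin 3 → ℤ)}
    (hT : ∀ n : ℕ, n ≠ 0 → n ≤ 4 * Z ^ g → #n.divisors ≤ T)
    (hS : ∀ s ∈ S, 0 < s 0 ∧ 0 < s 1 ∧ s 0 * s 1 ≤ Z) :
    #((S ×ˢ S).filter fun x => discForm g (x.1 0) (x.1 1) (x.1 2) =
      discForm g (x.2 0) (x.2 1) (x.2 2)) ≤ 2 * T * (g * T) ^ 2 * Z ^ 2 + 2 * (g * T) * #S := by
  have hcpos : ∀ s ∈ S, 0 < s 0 * s 1 := fun s hs => mul_pos (hS s hs).1 (hS s hs).2.1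
  have hcT : ∀ s ∈ S, #(s 0 * s 1).natAbs.divisors ≤ T := by
    intro s hs
    have h1 := hcpos s hs
    have h2 := (hS s hs).2.2
    refine hT _ (by omega) ?_
    have h3 : (s 0 * s 1).natAbs ≤ Z := by omega
    exact h3.trans ((Nat.le_self_pow (by omega) Z).trans (Nat.le_mul_of_pos_left _ (by norm_num)))
  have hfib : ∀ s ∈ S, ∀ e, #{x ∈ S | x 0 * x 1 = s 0 * s 1 ∧ discDiff g x = e} ≤ g * T :=
    fun s hs e => card_fiber_le hg (hcpos s hs).ne' (hcT s hs) (fun x hx => (hS x hx).1) e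
  set E := (S ×ˢ S).filter fun x => discForm g (x.1 0) (x.1 1) (x.1 2) =
      discForm g (x.2 0) (x.2 1) (x.2 2) with hE
  have hEeq : ∀ x ∈ E, (x.1 ∈ S ∧ x.2 ∈ S) ∧
      (discDiff g x.1 - discDiff g x.2) * (discDiff g x.1 + discDiff g x.2) =
        4 * ((x.1 0 * x.1 1) ^ g - (x.2 0 * x.2 1) ^ g) := by
    intro x hx
    obtain ⟨h1, h2⟩ := mem_filter.1 hx
    refine ⟨mem_product.1 h1, ?_⟩
    rw [discForm_eq_discDiff, discForm_eq_discDiff] at h2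
    linear_combination -h2
  -- Pairs are split according to whether the two products rC differ or agree.
  rw [← card_filter_add_card_filter_not (s := E) fun x => x.1 0 * x.1 1 ≠ x.2 0 * x.2 1]
  refine Nat.add_le_add ?_ ?_
  · refine (card_le_mul_card_image_of_maps_to
      (f := fun x => (x.1 0 * x.1 1, x.2 0 * x.2 1))
      (t := Icc (1 : ℤ) Z ×ˢ Icc (1 : ℤ) Z) (fun x hx => ?_) (2 * T * (g * T) ^ 2) ?_).trans ?_
    · obtain ⟨⟨h1, h2⟩, -⟩ := hEeq x (mem_filter.1 hx).1
      rw [mem_product, mem_Icc, mem_Icc]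
      exact ⟨⟨hcpos _ h1, (hS _ h1).2.2⟩, hcpos _ h2, (hS _ h2).2.2⟩
    · rintro ⟨c, c'⟩ hcc
      rw [mem_product, mem_Icc, mem_Icc] at hcc
      obtain ⟨⟨hc1, hcZ⟩, hc1', hcZ'⟩ := hcc
      simp only at hc1 hcZ hc1' hcZ'
      set n : ℤ := 4 * (c ^ g - c' ^ g) with hn
      by_cases hne : c = c'
      · rw [filter_eq_empty_iff.2]
        · simp
        · rintro x hx hxx
          simp only [Prod.mk.injEq] at hxx
          exact (mem_filter.1 hx).2 (by rw [hxx.1, hxx.2, hne])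
      have hn0 : n ≠ 0 := by
        intro h0
        apply hne
        have : c ^ g = c' ^ g := by linarith
        exact (pow_left_inj₀ (by omega) (by omega) (by omega)).1 this
      have hnT : #n.natAbs.divisors ≤ T := by
        refine hT _ (Int.natAbs_ne_zero.2 hn0) ?_
        have h1 : c ^ g ≤ (Z : ℤ) ^ g := pow_le_pow_left₀ (by omega) hcZ g
        have h2 : c' ^ g ≤ (Z : ℤ) ^ g := pow_le_pow_left₀ (by omega) hcZ' g
        have h3 : 0 < c ^ g := by positivity
        have h4 : 0 < c' ^ g := by positivity
        zify
        rw [abs_le]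
        constructor <;> linarith
      rw [mul_comm]
      refine (card_le_mul_card_image_of_maps_to
        (f := fun x => discDiff g x.1 - discDiff g x.2) (t := _) (fun x hx => ?_) ((g * T) ^ 2)
        ?_).trans (Nat.mul_le_mul_left _ (card_int_dvd_le hnT))
      · obtain ⟨hx1, hx2⟩ := mem_filter.1 hx
        obtain ⟨-, h3⟩ := hEeq x (mem_filter.1 hx1).1
        simp only [Prod.mk.injEq] at hx2
        rw [hx2.1, hx2.2, ← hn] at h3
        have hd : (discDiff g x.1 - discDiff g x.2) ∣ n := ⟨_, h3.symm⟩
        have hd' := Nat.mem_divisors.2 ⟨Int.natAbs_dvd_natAbs.2 hd, Int.natAbs_ne_zero.2 hn0⟩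
        rw [mem_union, mem_image, mem_image]
        rcases Int.natAbs_eq (discDiff g x.1 - discDiff g x.2) with h | h
        · exact Or.inl ⟨_, hd', h.symm⟩
        · exact Or.inr ⟨_, hd', h.symm⟩
      -- A divisor δ of n fixes both the difference and the sum n/δ of the two values of `discDiff`,
      -- hence both values.
      · intro δ _
        rcases Finset.eq_empty_or_nonempty (filter (fun x : (Fin 3 → ℤ) × (Fin 3 → ℤ) =>
          discDiff g x.1 - discDiff g x.2 = δ) (filter (fun x => (x.1 0 * x.1 1, x.2 0 * x.2 1) = (c, c'))
            (filter (fun x => x.1 0 * x.1 1 ≠ x.2 0 * x.2 1) E))) with h | ⟨y, hy⟩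
        · rw [h]; simp
        have key : ∀ x ∈ filter (fun x : (Fin 3 → ℤ) × (Fin 3 → ℤ) =>
          discDiff g x.1 - discDiff g x.2 = δ) (filter (fun x => (x.1 0 * x.1 1, x.2 0 * x.2 1) = (c, c'))
            (filter (fun x => x.1 0 * x.1 1 ≠ x.2 0 * x.2 1) E)),
            (x.1 ∈ S ∧ x.2 ∈ S) ∧ x.1 0 * x.1 1 = c ∧ x.2 0 * x.2 1 = c' ∧
              discDiff g x.1 - discDiff g x.2 = δ ∧ δ * (discDiff g x.1 + discDiff g x.2) = n := by
          intro x hx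
          obtain ⟨hx0, hxδ⟩ := mem_filter.1 hx
          obtain ⟨hx1, hx2⟩ := mem_filter.1 hx0
          obtain ⟨h3, h4⟩ := hEeq x (mem_filter.1 hx1).1
          simp only [Prod.mk.injEq] at hx2
          rw [hx2.1, hx2.2, ← hn, hxδ] at h4
          exact ⟨h3, hx2.1, hx2.2, hxδ, h4⟩
        obtain ⟨⟨hy1, hy2⟩, hyc, hyc', hyδ, hyn⟩ := key y hy
        have hδ0 : δ ≠ 0 := by rintro rfl; rw [zero_mul] at hyn; exact hn0 hyn.symm
        refine (card_le_card (t := {x ∈ S | x 0 * x 1 = y.1 0 * y.1 1 ∧ discDiff g x = discDiff g y.1} ×ˢ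
          {x ∈ S | x 0 * x 1 = y.2 0 * y.2 1 ∧ discDiff g x = discDiff g y.2}) fun x hx => ?_).trans ?_
        · obtain ⟨⟨hx1, hx2⟩, hxc, hxc', hxδ, hxn⟩ := key x hx
          have hsum := mul_left_cancel₀ hδ0 (hxn.trans hyn.symm)
          rw [mem_product, mem_filter, mem_filter]
          refine ⟨⟨hx1, hxc.trans hyc.symm, ?_⟩, hx2, hxc'.trans hyc'.symm, ?_⟩ <;> linarith
        · rw [card_product, sq]
          exact Nat.mul_le_mul (hfib _ hy1 _) (hfib _ hy2 _)
    · rw [card_product, Int.card_Icc]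
      simp [sq]
  · rw [mul_comm]
    refine (card_le_mul_card_image_of_maps_to (f := fun x => x.1) (t := S) (fun x hx => ?_)
      (2 * (g * T)) fun s hs => ?_).trans (le_of_eq (mul_comm _ _)) |>.trans (le_of_eq (by ring))
    · exact (hEeq x (mem_filter.1 hx).1).1.1
    -- With equal products rC, equal discriminants mean that the values of `discDiff` agree up to
    -- sign.
    · refine (card_le_card_of_injOn (t :=
        {x ∈ S | x 0 * x 1 = s 0 * s 1 ∧ discDiff g x = discDiff g s} ∪
        {x ∈ S | x 0 * x 1 = s 0 * s 1 ∧ discDiff g x = -discDiff g s}) (fun x => x.2)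
        (fun x hx => ?_) fun x hx y hy h => ?_).trans ((card_union_le _ _).trans ?_)
      · obtain ⟨hx0, rfl⟩ := mem_filter.1 (mem_coe.1 hx)
        obtain ⟨hx1, hx2⟩ := mem_filter.1 hx0
        push Not at hx2
        obtain ⟨h3, h4⟩ := hEeq x hx1
        rw [hx2, sub_self, mul_zero, mul_eq_zero] at h4
        rw [mem_coe, mem_union, mem_filter, mem_filter]
        rcases h4 with h4 | h4
        · exact Or.inl ⟨h3.2, hx2.symm, by linarith⟩
        · exact Or.inr ⟨h3.2, hx2.symm, by linarith⟩
      · have h1 := (mem_filter.1 (mem_coe.1 hx)).2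
        have h2 := (mem_filter.1 (mem_coe.1 hy)).2
        exact Prod.ext (h1.trans h2.symm) h
      · have := hfib s hs (discDiff g s)
        have := hfib s hs (-discDiff g s)
        omega

/-! ### Size of the discriminants and the count in one box -/

theorem powDiffQuot_le {g : ℕ} {c h : ℤ} {Y : ℝ} (hc : 0 ≤ c) (hh : 0 ≤ h) (hcY : (c : ℝ) ≤ Y)
    (hchY : (c + h : ℝ) ≤ Y) : ((powDiffQuot g c h : ℤ) : ℝ) ≤ g * Y ^ (g - 1) := by
  have hc' : (0 : ℝ) ≤ c := by exact_mod_cast hc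
  have hh' : (0 : ℝ) ≤ h := by exact_mod_cast hh
  have hY : 0 ≤ Y := hc'.trans hcY
  rw [powDiffQuot]
  push_cast
  calc _ ≤ ∑ i ∈ Finset.range g, Y ^ (g - 1) := by
        refine Finset.sum_le_sum fun i hi => ?_
        have hi' := Finset.mem_range.1 hi
        calc _ ≤ Y ^ i * Y ^ (g - 1 - i) := by gcongr
          _ = Y ^ (g - 1) := by rw [← pow_add]; congr 1; omega
    _ = g * Y ^ (g - 1) := by simp

/-- In the box `(R, 4R] × (M, 4M] × (H, 4H]` with `R ^ g ≍ M ^ (g - 2)` and `H ≍ M`, the sum `u + v` is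
small and the discriminant is of size `M ^ (2 g - 2)`. -/
theorem discForm_box_bounds {g : ℕ} (hg : 3 ≤ g) {R M H L : ℝ} (hL : L = 1 + g * 8 ^ (g - 1))
    (hM : 0 < M) (hR : 0 < R) (hH : 0 < H) (hRg : R ^ g = L ^ 2 * M ^ (g - 2))
    (hHM : H * (4 ^ (g + 1) * L ^ 2) = M) {r c h : ℤ}
    (hr : R < r ∧ (r : ℝ) ≤ 4 * R) (hc : M < c ∧ (c : ℝ) ≤ 4 * M) (hh : H < h ∧ (h : ℝ) ≤ 4 * H) :
    (h * r ^ g + powDiffQuot g c h) ^ 2 ≤ (r * (c + h)) ^ g ∧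
      (4 * (r * (c + h)) ^ g : ℝ) ≤ 4 * 32 ^ g * L ^ 2 * M ^ (2 * g - 2) := by
  have hL1 : 1 ≤ L := by rw [hL]; linarith [show (0 : ℝ) ≤ g * 8 ^ (g - 1) by positivity]
  have hHleM : H ≤ M := by
    rw [← hHM]
    refine le_mul_of_one_le_right hH.le ?_
    have h1 : (1 : ℝ) ≤ 4 ^ (g + 1) := one_le_pow₀ (by norm_num)
    have h2 : (1 : ℝ) ≤ L ^ 2 := one_le_pow₀ hL1
    nlinarith
  have hr0 : (0 : ℝ) < r := hR.trans hr.1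
  have hc0 : (0 : ℝ) < c := hM.trans hc.1
  have hh0 : (0 : ℝ) < h := hH.trans hh.1
  have hrc : (0 : ℤ) ≤ c := by exact_mod_cast hc0.le
  have hhc : (0 : ℤ) ≤ h := by exact_mod_cast hh0.le
  have hMM : M ^ (2 * g - 2) = M ^ (g - 2) * M ^ g := by rw [← pow_add]; congr 1; omega
  have hk : ((powDiffQuot g c h : ℤ) : ℝ) ≤ g * (8 * M) ^ (g - 1) :=
    powDiffQuot_le hrc hhc (by linarith [hc.2]) (by linarith [hc.2, hh.2])
  have hk0 : (0 : ℝ) ≤ ((powDiffQuot g c h : ℤ) : ℝ) := by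
    have : (0 : ℤ) ≤ powDiffQuot g c h := Finset.sum_nonneg fun i _ => by positivity
    exact_mod_cast this
  -- The choice of H gives 4H(4R)^g = M^(g-1). Together with v ≤ g(8M)^(g-1) this explains L, and
  -- R^g = L^2 M^(g-2) makes (RM)^g equal to (L M^(g-1))^2.
  have hu : (h * r ^ g : ℝ) ≤ M ^ (g - 1) := by
    calc (h * r ^ g : ℝ) ≤ (4 * H) * (4 * R) ^ g := by
          gcongr
          · exact hh.2
          · exact hr.2
      _ = H * (4 ^ (g + 1) * L ^ 2) * M ^ (g - 2) := by rw [mul_pow, hRg]; ring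
      _ = M ^ (g - 1) := by rw [hHM, ← pow_succ']; congr 1; omega
  have hb : (h * r ^ g + (powDiffQuot g c h : ℤ) : ℝ) ≤ L * M ^ (g - 1) := by
    rw [hL]
    rw [mul_pow] at hk
    linarith
  have ha : L ^ 2 * M ^ (2 * g - 2) ≤ (r * (c + h) : ℝ) ^ g := by
    calc L ^ 2 * M ^ (2 * g - 2) = (R * M) ^ g := by rw [mul_pow, hRg, hMM]; ring
      _ ≤ _ := by
        gcongr
        · exact hr.1.le
        · linarith [hc.1]
  constructor
  · have : (h * r ^ g + (powDiffQuot g c h : ℤ) : ℝ) ^ 2 ≤ (r * (c + h) : ℝ) ^ g := by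
      calc _ ≤ (L * M ^ (g - 1)) ^ 2 := pow_le_pow_left₀ (by positivity) hb 2
        _ = L ^ 2 * M ^ (2 * g - 2) := by
          rw [mul_pow, ← pow_mul]; congr 2; omega
        _ ≤ _ := ha
    exact_mod_cast this
  · calc (4 * (r * (c + h)) ^ g : ℝ) ≤ 4 * (4 * R * (8 * M)) ^ g := by
          gcongr
          · exact hr.2
          · linarith [hc.2, hh.2]
      _ = 4 * 32 ^ g * L ^ 2 * M ^ (2 * g - 2) := by
          rw [show 4 * R * (8 * M) = 32 * R * M by ring, mul_pow, mul_pow, hRg, hMM]; ring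

open Finset in
theorem card_box_le {S : Finset (Fin 3 → ℤ)} {B : Fin 3 → ℝ} (hB : ∀ j, 0 < B j)
    (hS : ∀ s ∈ S, ∀ j, B j < s j ∧ (s j : ℝ) ≤ 4 * B j) : (#S : ℝ) ≤ 64 * ∏ j, B j := by
  -- Starting the intervals at 1 leaves exactly ⌊4 B j⌋ integers, with no extra point.
  have h1 : S ⊆ Fintype.piFinset fun j => Icc (1 : ℤ) ⌊4 * B j⌋ := by
    intro s hs
    rw [Fintype.mem_piFinset]
    intro j
    have h2 := hS s hs j
    have h3 : (0 : ℤ) < s j := by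
      have := (hB j).trans h2.1
      exact_mod_cast this
    exact mem_Icc.2 ⟨h3, Int.le_floor.2 h2.2⟩
  have h2 : (#S : ℝ) ≤ ∏ j, (#(Icc (1 : ℤ) ⌊4 * B j⌋) : ℝ) := by
    exact_mod_cast (card_le_card h1).trans_eq (Fintype.card_piFinset _)
  refine h2.trans ?_
  calc ∏ j, (#(Icc (1 : ℤ) ⌊4 * B j⌋) : ℝ) ≤ ∏ j, 4 * B j := by
        refine prod_le_prod (fun j _ => by positivity) fun j _ => ?_
        have h3 : (0 : ℤ) ≤ ⌊4 * B j⌋ := Int.floor_nonneg.2 (by linarith [hB j])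
        have h4 : ((⌊4 * B j⌋.toNat : ℤ) : ℝ) ≤ 4 * B j := by
          rw [Int.toNat_of_nonneg h3]; exact Int.floor_le _
        rw [Int.card_Icc, add_sub_cancel_right]
        exact_mod_cast h4
    _ = 64 * ∏ j, B j := by simp [Fin.prod_univ_three]; ring

open Finset in
/-- Distinct discriminants coming from a box give distinct fields counted by
`classGroupEmbeddingCount`. -/
theorem card_image_discForm_le {g : ℕ} (hg : 3 ≤ g) {X : ℝ} {S : Finset (Fin 3 → ℤ)}
    (hS : ∀ s ∈ S, 0 < s 0 ∧ 1 < s 1 ∧ 0 < s 2 ∧ Squarefree (discForm g (s 0) (s 1) (s 2)) ∧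
      (s 2 * s 0 ^ g + powDiffQuot g (s 1) (s 2)) ^ 2 ≤ (s 0 * (s 1 + s 2)) ^ g ∧
      (4 * (s 0 * (s 1 + s 2)) ^ g : ℝ) ≤ X) :
    #(S.image fun s => discForm g (s 0) (s 1) (s 2)) ≤
      classGroupEmbeddingCount (ZMod g × ZMod g) X := by
  have hpos : ∀ s ∈ S, 1 < discForm g (s 0) (s 1) (s 2) ∧
      ((discForm g (s 0) (s 1) (s 2) : ℤ) : ℝ) ≤ X := by
    intro s hs
    obtain ⟨h0, h1, h2, -, h4, h5⟩ := hS s hs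
    have h6 := discForm_eq g (s 0) (s 1) (s 2)
    have h7 : 0 < (s 0 * (s 1 + s 2)) ^ g := by positivity
    refine ⟨by linarith, ?_⟩
    have h8 : discForm g (s 0) (s 1) (s 2) ≤ 4 * (s 0 * (s 1 + s 2)) ^ g := by
      rw [h6]; linarith [sq_nonneg (s 2 * s 0 ^ g + powDiffQuot g (s 1) (s 2))]
    have h9 : ((discForm g (s 0) (s 1) (s 2) : ℤ) : ℝ) ≤ 4 * (s 0 * (s 1 + s 2)) ^ g := by
      exact_mod_cast h8
    exact h9.trans h5
  have hinj : Set.InjOn Int.toNat (S.image fun s => discForm g (s 0) (s 1) (s 2) : Finset ℤ) := by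
    intro x hx y hy h
    obtain ⟨s, hs, rfl⟩ := mem_image.1 (mem_coe.1 hx)
    obtain ⟨t, ht, rfl⟩ := mem_image.1 (mem_coe.1 hy)
    have := (hpos s hs).1
    have := (hpos t ht).1
    omega
  rw [← card_image_of_injOn hinj, ← Set.ncard_coe_finset, classGroupEmbeddingCount]
  refine Set.ncard_le_ncard ?_ ?_
  · intro d hd
    rw [mem_coe, image_image] at hd
    obtain ⟨s, hs, rfl⟩ := mem_image.1 hd
    obtain ⟨h0, h1, h2, h3, h4, h5⟩ := hS s hs
    obtain ⟨h6, h7⟩ := hpos s hs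
    simp only [Function.comp_apply]
    have hcast : ((discForm g (s 0) (s 1) (s 2)).toNat : ℤ) = discForm g (s 0) (s 1) (s 2) :=
      Int.toNat_of_nonneg (by omega)
    have hsq : Squarefree (discForm g (s 0) (s 1) (s 2)).toNat := by
      rw [← Int.squarefree_natCast, hcast]; exact h3
    refine ⟨by omega, hsq, ?_, ?_⟩
    · have : (((discForm g (s 0) (s 1) (s 2)).toNat : ℤ) : ℝ) ≤ X := by rw [hcast]; exact h7
      exact_mod_cast this
    · have e0 : ((s 0).toNat : ℤ) = s 0 := Int.toNat_of_nonneg h0.le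
      have e1 : ((s 1).toNat : ℤ) = s 1 := Int.toNat_of_nonneg (by omega)
      have e2 : ((s 2).toNat : ℤ) = s 2 := Int.toNat_of_nonneg h2.le
      refine exists_injective_of_discForm (r := (s 0).toNat) (C := (s 1).toNat) (h := (s 2).toNat)
        hg (by omega) (by omega) (by omega) (by rw [hcast, e0, e1, e2]) hsq ?_
      rw [e0, e1, e2]
      have : 0 < (s 0 * (s 1 + s 2)) ^ g := by positivity
      linarith
  · refine (Set.finite_Iic ⌊X⌋₊).subset fun d hd => ?_
    exact Nat.le_floor hd.2.2.1

open Finset in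
/-- The count obtained from a single box. -/
theorem classGroupEmbeddingCount_box_ge {g : ℕ} (hg : 3 ≤ g) {R M H L X D : ℝ} {T : ℕ}
    (hL : L = 1 + g * 8 ^ (g - 1)) (hM : 1 ≤ M) (hR : 1 ≤ R) (hH : 0 < H)
    (hRg : R ^ g = L ^ 2 * M ^ (g - 2)) (hHM : H * (4 ^ (g + 1) * L ^ 2) = M)
    (hX : X = 4 * 32 ^ g * L ^ 2 * M ^ (2 * g - 2))
    (hT : ∀ n : ℕ, n ≠ 0 → (n : ℝ) ≤ X → #n.divisors ≤ T) (hD : 0 ≤ D)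
    (hbox : D * (R * M * H) ≤ (Set.ncard {x : Fin 3 → ℤ |
        (∀ j, ![R, M, H] j < x j ∧ (x j : ℝ) ≤ 4 * ![R, M, H] j) ∧
          Squarefree (MvPolynomial.eval x (discPoly g))} : ℝ)) :
    D ^ 2 * H ^ 2 ≤
      640 * g ^ 2 * T ^ 3 * (classGroupEmbeddingCount (ZMod g × ZMod g) X : ℝ) := by
  have hM0 : 0 < M := by linarith
  have hR0 : 0 < R := by linarith
  have hL1 : 1 ≤ L := by rw [hL]; linarith [show (0 : ℝ) ≤ g * 8 ^ (g - 1) by positivity]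
  have hBpos : ∀ j, 0 < ![R, M, H] j := by intro j; fin_cases j <;> assumption
  set V : Set (Fin 3 → ℤ) := {x : Fin 3 → ℤ |
        (∀ j, ![R, M, H] j < x j ∧ (x j : ℝ) ≤ 4 * ![R, M, H] j) ∧
          Squarefree (MvPolynomial.eval x (discPoly g))} with hV
  have hVfin : V.Finite := by
    refine (Set.Finite.pi' fun j => Set.finite_Icc (0 : ℤ) ⌊4 * ![R, M, H] j⌋).subset fun x hx j => ?_
    have h1 := (hBpos j).trans (hx.1 j).1
    exact ⟨by exact_mod_cast h1.le, Int.le_floor.2 (hx.1 j).2⟩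
  set S : Finset (Fin 3 → ℤ) := hVfin.toFinset with hS
  have hSV : ∀ s ∈ S, s ∈ V := fun s hs => hVfin.mem_toFinset.1 hs
  rw [Set.ncard_eq_toFinset_card V hVfin, ← hS] at hbox
  have hbd : ∀ s ∈ S, (R < s 0 ∧ (s 0 : ℝ) ≤ 4 * R) ∧ (M < s 1 ∧ (s 1 : ℝ) ≤ 4 * M) ∧
      (H < s 2 ∧ (s 2 : ℝ) ≤ 4 * H) := fun s hs =>
    ⟨(hSV s hs).1 0, (hSV s hs).1 1, (hSV s hs).1 2⟩
  have hpos : ∀ s ∈ S, 0 < s 0 ∧ 1 < s 1 ∧ 0 < s 2 := by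
    intro s hs
    obtain ⟨h0, h1, h2⟩ := hbd s hs
    refine ⟨?_, ?_, ?_⟩
    · have := hR0.trans h0.1; exact_mod_cast this
    · have := hM.trans_lt h1.1; exact_mod_cast this
    · have := hH.trans h2.1; exact_mod_cast this
  have himg := card_image_discForm_le hg (X := X) (S := S) (by
    intro s hs
    obtain ⟨h0, h1, h2⟩ := hpos s hs
    obtain ⟨e0, e1, e2⟩ := hbd s hs
    obtain ⟨k1, k2⟩ := discForm_box_bounds hg hL hM0 hR0 hH hRg hHM e0 e1 e2
    refine ⟨h0, h1, h2, ?_, k1, hX ▸ k2⟩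
    rw [← eval_discPoly]; exact (hSV s hs).2)
  set Z : ℕ := ⌊16 * (R * M)⌋₊ with hZ
  have hZle : (Z : ℝ) ≤ 16 * (R * M) := Nat.floor_le (by positivity)
  have hpair := card_discForm_eq_le hg (S := S) (T := T) (Z := Z) (by
    intro n hn hnZ
    refine hT n hn ?_
    have h1 : (n : ℝ) ≤ 4 * (Z : ℝ) ^ g := by exact_mod_cast hnZ
    refine h1.trans ?_
    calc 4 * (Z : ℝ) ^ g ≤ 4 * (32 * (R * M)) ^ g := by
          gcongr
          refine hZle.trans ?_
          have : 0 < R * M := by positivity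
          linarith
      _ = X := by
          rw [hX, mul_pow, mul_pow, hRg, show 2 * g - 2 = (g - 2) + g by omega, pow_add]; ring) (by
    intro s hs
    obtain ⟨h0, h1, h2⟩ := hpos s hs
    refine ⟨h0, by omega, ?_⟩
    obtain ⟨e0, e1, e2⟩ := hbd s hs
    have h3 : (s 0 * s 1 : ℝ) ≤ 16 * (R * M) := by
      have := mul_le_mul e0.2 e1.2 (by linarith [e1.1]) (by linarith)
      linarith
    have h4 : (s 0 * s 1).toNat ≤ Z := by
      refine Nat.le_floor ?_
      have h5 : (((s 0 * s 1).toNat : ℤ) : ℝ) = s 0 * s 1 := by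
        rw [Int.toNat_of_nonneg (mul_nonneg h0.le (by omega))]; push_cast; rfl
      have h6 : ((s 0 * s 1).toNat : ℝ) = s 0 * s 1 := by exact_mod_cast h5
      rw [h6]; exact h3
    omega)
  have hcs := card_sq_le_card_image_mul S fun s => discForm g (s 0) (s 1) (s 2)
  have hScard : (#S : ℝ) ≤ 64 * (R * M * H) := by
    have := card_box_le hBpos fun s hs => (hSV s hs).1
    simpa [Fin.prod_univ_three] using this
  have hT1 : 1 ≤ T := by
    have := hT 1 one_ne_zero (by
      rw [hX]; push_cast
      have h1 : (1 : ℝ) ≤ 32 ^ g := one_le_pow₀ (by norm_num)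
      have h2 : (1 : ℝ) ≤ L ^ 2 := one_le_pow₀ hL1
      have h3 : (1 : ℝ) ≤ M ^ (2 * g - 2) := one_le_pow₀ hM
      have h4 : (1 : ℝ) ≤ 32 ^ g * L ^ 2 := by nlinarith
      nlinarith)
    simpa using this
  have hHleM : H ≤ M := by
    rw [← hHM]
    refine le_mul_of_one_le_right hH.le ?_
    have h1 : (1 : ℝ) ≤ 4 ^ (g + 1) := one_le_pow₀ (by norm_num)
    have h2 : (1 : ℝ) ≤ L ^ 2 := one_le_pow₀ hL1
    nlinarith
  set N : ℕ := classGroupEmbeddingCount (ZMod g × ZMod g) X with hN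
  have h1 : #S ^ 2 ≤ N * (2 * T * (g * T) ^ 2 * Z ^ 2 + 2 * (g * T) * #S) :=
    hcs.trans (Nat.mul_le_mul himg hpair)
  have h2 : (#S : ℝ) ^ 2 ≤ N * (2 * T * (g * T) ^ 2 * Z ^ 2 + 2 * (g * T) * #S) := by
    exact_mod_cast h1
  -- Since H ≤ M ≤ RM, the diagonal term is also O((RM)^2): the constants are 2·256 + 2·64 = 640.
  have hRM : 0 < R * M := by positivity
  have hSRM : (#S : ℝ) ≤ 64 * (R * M) ^ 2 := by
    refine hScard.trans ?_
    have : R * M * H ≤ R * M * (R * M) := by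
      gcongr
      nlinarith
    rw [sq]; linarith
  have hgT : (g : ℝ) * T ≤ g ^ 2 * T ^ 3 := by
    have : g * T ≤ g ^ 2 * T ^ 3 :=
      Nat.mul_le_mul (Nat.le_self_pow two_ne_zero g) (Nat.le_self_pow three_ne_zero T)
    exact_mod_cast this
  have h3 : 2 * T * ((g : ℝ) * T) ^ 2 * (Z : ℝ) ^ 2 + 2 * (g * T) * #S ≤
      640 * g ^ 2 * T ^ 3 * (R * M) ^ 2 := by
    have e1 : (Z : ℝ) ^ 2 ≤ 256 * (R * M) ^ 2 := by
      calc (Z : ℝ) ^ 2 ≤ (16 * (R * M)) ^ 2 := pow_le_pow_left₀ (by positivity) hZle 2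
        _ = _ := by ring
    calc 2 * T * ((g : ℝ) * T) ^ 2 * (Z : ℝ) ^ 2 + 2 * (g * T) * #S
        ≤ 2 * T * ((g : ℝ) * T) ^ 2 * (256 * (R * M) ^ 2) +
          2 * (g ^ 2 * T ^ 3) * (64 * (R * M) ^ 2) := by gcongr
      _ = 640 * g ^ 2 * T ^ 3 * (R * M) ^ 2 := by ring
  have h4 : (D * (R * M * H)) ^ 2 ≤ N * (640 * g ^ 2 * T ^ 3 * (R * M) ^ 2) :=
    (pow_le_pow_left₀ (by positivity) hbox 2).trans
      (h2.trans (mul_le_mul_of_nonneg_left h3 (Nat.cast_nonneg N)))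
  have h5 : (D ^ 2 * H ^ 2) * (R * M) ^ 2 ≤ (640 * g ^ 2 * T ^ 3 * N) * (R * M) ^ 2 := by
    linarith
  exact le_of_mul_le_mul_right h5 (by positivity)

/-! ### Choice of parameters and conclusion -/

open Filter in
theorem theorem3p4 (hconj : SquarefreeDensityConjecture) (g : ℕ) (hg : 5 ≤ g)
    (ε : ℝ) (hε : 0 < ε) :
    ∃ c : ℝ, 0 < c ∧ ∃ X₀ : ℝ, ∀ X : ℝ, X₀ ≤ X →
      c * X ^ (1 / ((g : ℝ) - 1) - ε) ≤
        (classGroupEmbeddingCount (ZMod g × ZMod g) X : ℝ) := by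
  have hg3 : 3 ≤ g := by omega
  have hDpos := squarefreeDensity_discPoly_pos hg3
  set D := squarefreeDensity (discPoly g) with hD
  obtain ⟨B₀, hB₀⟩ := exists_card_box_ge hconj (two_le_totalDegree_discPoly (by omega)) hDpos
  -- The divisor bound enters cubed, hence the exponent ε/3.
  obtain ⟨K, hK1, hK⟩ := exists_card_divisors_le (δ := ε / 3) (by positivity)
  set L : ℝ := 1 + g * 8 ^ (g - 1) with hL
  have hLpos : 0 < L := by positivity
  set κ : ℝ := 4 * 32 ^ g * L ^ 2 with hκ
  have hκpos : 0 < κ := by positivity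
  set δ : ℝ := (4 ^ (g + 1) * L ^ 2)⁻¹ with hδ
  have hδpos : 0 < δ := by positivity
  -- M is chosen so that κ M^(2g-2), the upper bound for the discriminants in the box, is exactly X.
  set M : ℝ → ℝ := fun X => (X / κ) ^ (((2 * g - 2 : ℕ) : ℝ)⁻¹) with hM
  set R : ℝ → ℝ := fun X => (L ^ 2 * M X ^ (g - 2)) ^ ((g : ℝ)⁻¹) with hR
  have hexp : 0 < (((2 * g - 2 : ℕ) : ℝ)⁻¹) := by
    have : (0 : ℝ) < ((2 * g - 2 : ℕ) : ℝ) := by exact_mod_cast (by omega : 0 < 2 * g - 2)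
    positivity
  have hgpos : (0 : ℝ) < g := by exact_mod_cast (by omega : 0 < g)
  have hMtop : Tendsto M atTop atTop :=
    (tendsto_rpow_atTop hexp).comp (tendsto_id.atTop_div_const hκpos)
  have hRtop : Tendsto R atTop atTop :=
    (tendsto_rpow_atTop (inv_pos.2 hgpos)).comp
      (((tendsto_pow_atTop (by omega)).comp hMtop).const_mul_atTop (by positivity))
  have hHtop : Tendsto (fun X => M X * δ) atTop atTop := hMtop.atTop_mul_const hδpos
  have hev : ∀ᶠ X in atTop, (1 ≤ X ∧ 1 ≤ M X ∧ 1 ≤ R X) ∧ B₀ ≤ M X ∧ B₀ ≤ R X ∧ B₀ ≤ M X * δ := by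
    filter_upwards [eventually_ge_atTop 1, hMtop.eventually_ge_atTop 1, hRtop.eventually_ge_atTop 1,
      hMtop.eventually_ge_atTop B₀, hRtop.eventually_ge_atTop B₀, hHtop.eventually_ge_atTop B₀]
      with X h1 h2 h3 h4 h5 h6
    exact ⟨⟨h1, h2, h3⟩, h4, h5, h6⟩
  obtain ⟨X₀, hX₀⟩ := eventually_atTop.1 hev
  set b : ℝ := 640 * g ^ 2 * K ^ 3 with hb
  have hbpos : 0 < b := by positivity
  refine ⟨D ^ 2 * δ ^ 2 * (κ ^ (1 / ((g : ℝ) - 1)))⁻¹ / b, by positivity, X₀, fun X hX => ?_⟩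
  obtain ⟨⟨hX1, hM1, hR1⟩, hBM, hBR, hBH⟩ := hX₀ X hX
  have hXpos : 0 < X := by linarith
  have hXε : 0 < X ^ ε := Real.rpow_pos_of_pos hXpos _
  have hRg : R X ^ g = L ^ 2 * M X ^ (g - 2) :=
    Real.rpow_inv_natCast_pow (by positivity) (by omega)
  have hMX : M X ^ (2 * g - 2) = X / κ := Real.rpow_inv_natCast_pow (by positivity) (by omega)
  have hMsq : M X ^ 2 = X ^ (1 / ((g : ℝ) - 1)) * (κ ^ (1 / ((g : ℝ) - 1)))⁻¹ := by
    rw [← div_eq_mul_inv, ← Real.div_rpow hXpos.le hκpos.le, hM]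
    simp only
    rw [← Real.rpow_natCast, ← Real.rpow_mul (by positivity)]
    congr 1
    have hg1 : (g : ℝ) - 1 ≠ 0 := by
      have : (5 : ℝ) ≤ g := by exact_mod_cast hg
      intro h; linarith
    rw [Nat.cast_sub (by omega)]
    push_cast
    rw [show (2 * (g : ℝ) - 2) = 2 * (g - 1) by ring]
    field_simp
  set T : ℕ := ⌊K * X ^ (ε / 3)⌋₊ with hT
  have hTle : (T : ℝ) ^ 3 ≤ K ^ 3 * X ^ ε := by
    calc (T : ℝ) ^ 3 ≤ (K * X ^ (ε / 3)) ^ 3 :=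
          pow_le_pow_left₀ (by positivity) (Nat.floor_le (by positivity)) 3
      _ = K ^ 3 * X ^ ε := by
          rw [mul_pow, ← Real.rpow_natCast (X ^ (ε / 3)), ← Real.rpow_mul hXpos.le]
          congr 2
          push_cast
          ring
  have hmain := classGroupEmbeddingCount_box_ge (g := g) (R := R X) (M := M X) (H := M X * δ)
    (X := X) (D := D) (T := T) hg3 hL hM1 hR1 (by positivity) hRg
    (by rw [hδ]; field_simp) (by rw [hMX, ← hκ]; field_simp) (by
      intro n hn hnX
      refine Nat.le_floor ((hK n hn).trans ?_)
      gcongr) hDpos.le (by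
      have h := hB₀ ![R X, M X, M X * δ] (by intro j; fin_cases j <;> assumption)
      simpa [Fin.prod_univ_three] using h)
  set N : ℝ := (classGroupEmbeddingCount (ZMod g × ZMod g) X : ℝ) with hN
  have hN0 : 0 ≤ N := Nat.cast_nonneg _
  have h1 : D ^ 2 * δ ^ 2 * M X ^ 2 ≤ b * X ^ ε * N := by
    calc D ^ 2 * δ ^ 2 * M X ^ 2 = D ^ 2 * (M X * δ) ^ 2 := by ring
      _ ≤ 640 * g ^ 2 * T ^ 3 * N := hmain
      _ ≤ 640 * g ^ 2 * (K ^ 3 * X ^ ε) * N := by gcongr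
      _ = b * X ^ ε * N := by rw [hb]; ring
  rw [Real.rpow_sub hXpos]
  rw [hMsq] at h1
  rw [div_mul_div_comm, div_le_iff₀ (by positivity)]
  linarith
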